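/- For $n\ge 0$ the key polynomials $\{\mathcal K_\alpha\}_{\alpha\in\mathbb Z_{\ge 0}^n}\subset\mathbb Z[x_1,\dots,x_n]$ are the unique family such that $\mathcal K_\alpha=x^\alpha$ if $\alpha_1\ge\cdots\ge\alpha_n$, and $\mathcal K_{s_i(\alpha)}=\xi_i(\mathcal K_\alpha)$ whenever $\alpha_i>\alpha_{i+1}$, where $s_i$ interchanges the entries (respectively the variables) $i$ and $i+1$ and $\xi_i(f)=\frac{x_i f-x_{i+1}s_i(f)}{x_i-x_{i+1}}$. Let $\mathrm{Par}$ be the set of all partitions, and let $\ell(\lambda)$ be the number of (nonzero) parts of $\lambda \in \mathrm{Par}$. Let $r\ge 0$, and let $X_i=\{x_{i,1},x_{i,2},\dots\}$, $1\le i\le r$, be infinite sets of variables. For $\underline\lambda=(\lambda^{(1)}|\cdots|\lambda^{(r)})\in\mathrm{Par}^r$ and $n_i\ge\ell(\lambda^{(i)})$ put $$\mathcal S_{\underline\lambda}^{(n_1|\cdots|n_r)}=\mathcal K_{(0^{n_1-\ell(\lambda^{(1)})}*\mathrm{rev}(\lambda^{(1)}))*\cdots*(0^{n_r-\ell(\lambda^{(r)})}*\mathrm{rev}(\lambda^{(r)}))}(x_{1,1},\dots,x_{1,n_1},\dots,x_{r,1},\dots,x_{r,n_r}),$$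 where $*$ is concatenation and $\mathrm{rev}(\lambda)$ lists the parts of $\lambda$ in weakly increasing order. The multi-symmetric Schur function $\mathcal S_{\underline\lambda}$ is the limit of $\mathcal S_{\underline\lambda}^{(n_1|\cdots|n_r)}$ as $n_1,\dots,n_r\to\infty$, taken coefficientwise (each coefficient being eventually constant) in the ring of formal power series over $\mathbb Z$ in the variables $x_{i,j}$. Let $\Lambda_{\mathbb Z}(X)$ be the ring of symmetric functions (symmetric formal power series of bounded degree) over $\mathbb Z$ in the variables $X$, and let $\Lambda_{\mathbb Z}(X_1|\cdots|X_r)=\Lambda_{\mathbb Z}(X_1)\otimes_{\mathbb Z}\cdots\otimes_{\mathbb Z}\Lambda_{\mathbb Z}(X_r)$. Then all these limits exist; the map $f_1\otimes\cdots\otimes f_r\mapsto f_1(X_1)\cdots f_r(X_r)$ from $\Lambda_{\mathbb Z}(X_1|\cdots|X_r)$ to the ring of formal power series in the $x_{i,j}$ is injective; and, when $\Lambda_{\mathbb Z}(X_1|\cdots|X_r)$ is identified with its image under this map, the multi-symmetric Schur functions $\mathcal S_{\underline\lambda}$, $\underline\lambda\in\mathrm{Par}^r$, belong to $\Lambda_{\mathbb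 Z}(X_1|\cdots|X_r)$ and form a $\mathbb Z$-basis of it. -/

import Mathlib

open Filter Topology
open scoped TensorProduct MvPowerSeries.WithPiTopology

namespace MultiSchur

noncomputable section

/-! ### Isobaric divided difference operators -/

section Operators

variable {σ R : Type*} [DecidableEq σ] [CommRing R]

/-- `s_{x,y} f`: the polynomial `f` with the variables `x` and `y` interchanged. -/
def swapVar (x y : σ) : MvPolynomial σ R →ₐ[R] MvPolynomial σ R :=
  MvPolynomial.rename (Equiv.swap x y)

theorem X_sub_X_dvd_sub_swapVar (x y : σ) (f : MvPolynomial σ R) :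
    (MvPolynomial.X x - MvPolynomial.X y) ∣ f - swapVar x y f := by
  induction f using MvPolynomial.induction_on with
  | C a => simp [swapVar]
  | add p q hp hq =>
    rw [map_add, add_sub_add_comm]
    exact dvd_add hp hq
  | mul_X p z hp =>
    have hz : (MvPolynomial.X x - MvPolynomial.X y : MvPolynomial σ R) ∣
        MvPolynomial.X z - swapVar x y (MvPolynomial.X z) := by
      simp only [swapVar, MvPolynomial.rename_X]
      by_cases hx : z = x
      · subst hx; simp
      · by_cases hy : z = y
        · subst hy
          rw [Equiv.swap_apply_right]
          exact ⟨-1, by ring⟩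
        · simp [Equiv.swap_apply_of_ne_of_ne hx hy]
    have : p * MvPolynomial.X z - swapVar x y (p * MvPolynomial.X z) =
        (p - swapVar x y p) * MvPolynomial.X z +
          swapVar x y p * (MvPolynomial.X z - swapVar x y (MvPolynomial.X z)) := by
      rw [map_mul]; ring
    rw [this]
    exact dvd_add (hp.mul_right _) (hz.mul_left _)

theorem X_sub_X_dvd (x y : σ) (f : MvPolynomial σ R) :
    (MvPolynomial.X x - MvPolynomial.X y) ∣
      MvPolynomial.X x * f - MvPolynomial.X y * swapVar x y f := by
  have : MvPolynomial.X x * f - MvPolynomial.X y * swapVar x y f =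
      (MvPolynomial.X x - MvPolynomial.X y) * f +
        MvPolynomial.X y * (f - swapVar x y f) := by ring
  rw [this]
  exact dvd_add (dvd_mul_right _ _) ((X_sub_X_dvd_sub_swapVar x y f).mul_left _)

/-- The isobaric divided difference `ξ_{x,y} f = (x f - y s_{x,y} f) / (x - y)`. -/
def isobaric (x y : σ) (f : MvPolynomial σ R) : MvPolynomial σ R :=
  (X_sub_X_dvd x y f).choose

theorem isobaric_spec (x y : σ) (f : MvPolynomial σ R) :
    (MvPolynomial.X x - MvPolynomial.X y) * isobaric x y f =
      MvPolynomial.X x * f - MvPolynomial.X y * swapVar x y f :=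
  (X_sub_X_dvd x y f).choose_spec.symm

end Operators

/-! ### Key polynomials -/

/-- The defining properties of the family of key polynomials in `n` variables (indexed by
`Fin n`): `K_α = x^α` for weakly decreasing `α`, and `K_{s_i α} = ξ_i K_α` if `α_i > α_{i+1}`. -/
structure IsKeyFamily (R : Type*) [CommRing R] (n : ℕ)
    (K : (Fin n → ℕ) → MvPolynomial (Fin n) R) : Prop where
  of_antitone : ∀ α : Fin n → ℕ, Antitone α → K α = ∏ i, MvPolynomial.X i ^ α i
  of_descent : ∀ (α : Fin n → ℕ) (i j : Fin n), (i : ℕ) + 1 = j → α j < α i →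
    K (α ∘ Equiv.swap i j) = isobaric i j (K α)

/-- A pair of adjacent positions at which `α` increases. -/
def IsAscent {n : ℕ} (α : Fin n → ℕ) (p : Fin n × Fin n) : Prop :=
  (p.1 : ℕ) + 1 = p.2 ∧ α p.1 < α p.2

theorem weight_swap_lt {n : ℕ} {α : Fin n → ℕ} {p : Fin n × Fin n} (h : IsAscent α p) :
    ∑ k : Fin n, (k : ℕ) * (α ∘ Equiv.swap p.1 p.2) k < ∑ k : Fin n, (k : ℕ) * α k := by
  obtain ⟨i, j⟩ := p
  obtain ⟨hij, hlt⟩ := h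
  simp only at hij hlt
  have hne : j ≠ i := by
    intro h
    rw [h] at hij
    omega
  rw [← Finset.add_sum_erase _ _ (Finset.mem_univ i),
    ← Finset.add_sum_erase (Finset.univ.erase i) _ (Finset.mem_erase.2 ⟨hne, Finset.mem_univ j⟩),
    ← Finset.add_sum_erase _ (fun k : Fin n => (k : ℕ) * α k) (Finset.mem_univ i),
    ← Finset.add_sum_erase (Finset.univ.erase i) (fun k : Fin n => (k : ℕ) * α k)
      (Finset.mem_erase.2 ⟨hne, Finset.mem_univ j⟩)]
  have hrest : ∑ k ∈ (Finset.univ.erase i).erase j, (k : ℕ) * (α ∘ Equiv.swap i j) k =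
      ∑ k ∈ (Finset.univ.erase i).erase j, (k : ℕ) * α k := by
    refine Finset.sum_congr rfl fun k hk => ?_
    simp only [Finset.mem_erase] at hk
    simp [Equiv.swap_apply_of_ne_of_ne hk.2.1 hk.1]
  rw [hrest]
  simp only [Function.comp_apply, Equiv.swap_apply_left, Equiv.swap_apply_right]
  rw [← hij]
  nlinarith

open Classical in
/-- The key polynomial `K_α ∈ R[x_1, …, x_n]`, computed by sorting `α` into weakly decreasing
order. By `isKeyFamily_keyPoly` and `IsKeyFamily.eq_keyPoly` these polynomials are the unique
family with the defining properties of the key polynomials. -/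
def keyPoly (R : Type*) [CommRing R] (n : ℕ) (α : Fin n → ℕ) : MvPolynomial (Fin n) R :=
  if h : ∃ p, IsAscent α p then
    isobaric h.choose.1 h.choose.2 (keyPoly R n (α ∘ Equiv.swap h.choose.1 h.choose.2))
  else ∏ i, MvPolynomial.X i ^ α i
termination_by ∑ k : Fin n, (k : ℕ) * α k
decreasing_by exact weight_swap_lt h.choose_spec

section KeyFamily

variable {R : Type*} [CommRing R]

theorem antitone_of_not_isAscent {n : ℕ} {α : Fin n → ℕ} (h : ¬ ∃ p, IsAscent α p) :
    Antitone α := by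
  cases n with
  | zero => exact fun i => i.elim0
  | succ m =>
    rw [Fin.antitone_iff_succ_le]
    intro i
    by_contra hlt
    exact h ⟨(i.castSucc, i.succ), by simp, not_le.1 hlt⟩

theorem not_isAscent_of_antitone {n : ℕ} {α : Fin n → ℕ} (h : Antitone α) :
    ¬ ∃ p, IsAscent α p := by
  rintro ⟨p, hp, hlt⟩
  exact absurd (h (show p.1 ≤ p.2 from Fin.le_def.2 (by omega))) (not_le.2 hlt)

variable {σ : Type*} [DecidableEq σ]

@[simp]
theorem swapVar_X_left (x y : σ) :
    swapVar x y (MvPolynomial.X x : MvPolynomial σ R) = MvPolynomial.X y := by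
  simp [swapVar]

@[simp]
theorem swapVar_X_right (x y : σ) :
    swapVar x y (MvPolynomial.X y : MvPolynomial σ R) = MvPolynomial.X x := by
  simp [swapVar]

theorem swapVar_X_of_ne {x y z : σ} (hx : z ≠ x) (hy : z ≠ y) :
    swapVar x y (MvPolynomial.X z : MvPolynomial σ R) = MvPolynomial.X z := by
  simp [swapVar, Equiv.swap_apply_of_ne_of_ne hx hy]

@[simp]
theorem swapVar_swapVar (x y : σ) (f : MvPolynomial σ R) :
    swapVar x y (swapVar x y f) = f := by
  have : (Equiv.swap x y : σ → σ) ∘ Equiv.swap x y = id := by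
    funext z; simp
  simp [swapVar, MvPolynomial.rename_rename, this]

variable [IsDomain R]

theorem X_sub_X_ne_zero {τ : Type*} {x y : τ} (h : x ≠ y) :
    (MvPolynomial.X x - MvPolynomial.X y : MvPolynomial τ R) ≠ 0 :=
  sub_ne_zero.2 fun hxy => h (MvPolynomial.X_injective hxy)

theorem swapVar_isobaric {x y : σ} (h : x ≠ y) (f : MvPolynomial σ R) :
    swapVar x y (isobaric x y f) = isobaric x y f := by
  have h1 := isobaric_spec x y f
  have h2 := congrArg (swapVar x y) h1
  simp only [map_mul, map_sub, swapVar_X_left, swapVar_X_right, swapVar_swapVar] at h2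
  refine mul_left_cancel₀ (X_sub_X_ne_zero (R := R) h) ?_
  linear_combination -h1 - h2

theorem isobaric_comm {a b c d : σ} (hab : a ≠ b) (hcd : c ≠ d) (hac : a ≠ c) (had : a ≠ d)
    (hbc : b ≠ c) (hbd : b ≠ d) (f : MvPolynomial σ R) :
    isobaric a b (isobaric c d f) = isobaric c d (isobaric a b f) := by
  have hs : swapVar a b (swapVar c d f) = swapVar c d (swapVar a b f) := by
    have : (Equiv.swap a b : σ → σ) ∘ Equiv.swap c d = Equiv.swap c d ∘ Equiv.swap a b := by
      funext z
      simp only [Function.comp_apply, Equiv.swap_apply_def]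
      grind
    simp [swapVar, MvPolynomial.rename_rename, this]
  have e1 := isobaric_spec a b (isobaric c d f)
  have e2 := isobaric_spec c d f
  have e3 := congrArg (swapVar a b) e2
  have f1 := isobaric_spec c d (isobaric a b f)
  have f2 := isobaric_spec a b f
  have f3 := congrArg (swapVar c d) f2
  simp only [map_mul, map_sub, swapVar_X_of_ne hac.symm hbc.symm,
    swapVar_X_of_ne had.symm hbd.symm] at e3
  simp only [map_mul, map_sub, swapVar_X_of_ne hac had, swapVar_X_of_ne hbc hbd] at f3
  refine mul_left_cancel₀ (mul_ne_zero (X_sub_X_ne_zero (R := R) hab)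
    (X_sub_X_ne_zero (R := R) hcd)) ?_
  linear_combination (MvPolynomial.X c - MvPolynomial.X d) * e1 + MvPolynomial.X a * e2 -
    MvPolynomial.X b * e3 - (MvPolynomial.X a - MvPolynomial.X b) * f1 - MvPolynomial.X c * f2 +
    MvPolynomial.X d * f3 + MvPolynomial.X b * MvPolynomial.X d * hs

theorem isobaric_braid {a b c : σ} (hab : a ≠ b) (hbc : b ≠ c) (hac : a ≠ c)
    (f : MvPolynomial σ R) :
    isobaric a b (isobaric b c (isobaric a b f)) =
      isobaric b c (isobaric a b (isobaric b c f)) := by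
  have hs : swapVar a b (swapVar b c (swapVar a b f)) =
      swapVar b c (swapVar a b (swapVar b c f)) := by
    have : ((Equiv.swap a b : σ → σ) ∘ Equiv.swap b c) ∘ Equiv.swap a b =
        (Equiv.swap b c ∘ Equiv.swap a b) ∘ Equiv.swap b c := by
      funext z
      simp only [Function.comp_apply, Equiv.swap_apply_def]
      grind
    simp only [swapVar, MvPolynomial.rename_rename]
    rw [← Function.comp_assoc, ← Function.comp_assoc, this]
  have e1 := isobaric_spec a b (isobaric b c (isobaric a b f))
  have e2 := isobaric_spec b c (isobaric a b f)
  have e3 := congrArg (swapVar a b) e2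
  have e4 := isobaric_spec a b f
  have e5 := congrArg (swapVar b c) e4
  have e6 := congrArg (swapVar a b) e5
  have f1 := isobaric_spec b c (isobaric a b (isobaric b c f))
  have f2 := isobaric_spec a b (isobaric b c f)
  have f3 := congrArg (swapVar b c) f2
  have f4 := isobaric_spec b c f
  have f5 := congrArg (swapVar a b) f4
  have f6 := congrArg (swapVar b c) f5
  simp only [map_mul, map_sub, swapVar_X_left, swapVar_X_right,
    swapVar_X_of_ne hab hac, swapVar_X_of_ne hac.symm hbc.symm,
    swapVar_isobaric hab, swapVar_isobaric hbc] at e3 e5 e6 f3 f5 f6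
  refine mul_left_cancel₀ (mul_ne_zero (mul_ne_zero (X_sub_X_ne_zero (R := R) hab)
    (X_sub_X_ne_zero (R := R) hbc)) (X_sub_X_ne_zero (R := R) hac)) ?_
  set A : MvPolynomial σ R := MvPolynomial.X a
  set B : MvPolynomial σ R := MvPolynomial.X b
  set C : MvPolynomial σ R := MvPolynomial.X c
  linear_combination (B - C) * (A - C) * e1 + A * (A - C) * e2 - B * (B - C) * e3 + A * B * e4
    - A * C * e5 + B * C * e6
    - ((A - B) * (A - C) * f1 + B * (A - C) * f2 - C * (A - B) * f3 + A ^ 2 * f4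
    - B ^ 2 * f5 + C ^ 2 * f6) - B * C ^ 2 * hs

theorem comp_swap_swap {n : ℕ} (α : Fin n → ℕ) (i j : Fin n) :
    (α ∘ Equiv.swap i j) ∘ Equiv.swap i j = α := by
  funext k; simp

theorem keyPoly_of_ascent {n : ℕ} (α : Fin n → ℕ) (p : Fin n × Fin n) (hp : IsAscent α p) :
    keyPoly R n α = isobaric p.1 p.2 (keyPoly R n (α ∘ Equiv.swap p.1 p.2)) := by
  obtain ⟨N, hN⟩ : ∃ N, N = ∑ k : Fin n, (k : ℕ) * α k := ⟨_, rfl⟩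
  induction N using Nat.strong_induction_on generalizing α p with
  | _ N ih =>
    subst hN
    -- two consecutive ascents
    have braid : ∀ a b c : Fin n, IsAscent α (a, b) → IsAscent α (b, c) →
        isobaric a b (keyPoly R n (α ∘ Equiv.swap a b)) =
          isobaric b c (keyPoly R n (α ∘ Equiv.swap b c)) := by
      intro a b c h1 h2
      have hab : a ≠ b := fun h => by have := h1.1; simp [h] at this
      have hbc : b ≠ c := fun h => by have := h2.1; simp [h] at this
      have hac : a ≠ c := fun h => by have h1 := h1.1; have h2 := h2.1; simp [h] at h1 h2; omega
      obtain ⟨h1a, h1b⟩ := h1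
      obtain ⟨h2a, h2b⟩ := h2
      simp only at h1a h1b h2a h2b
      have w1 := weight_swap_lt (α := α) (p := (a, b)) ⟨h1a, h1b⟩
      have w2 := weight_swap_lt (α := α) (p := (b, c)) ⟨h2a, h2b⟩
      have x1 : IsAscent (α ∘ Equiv.swap a b) (b, c) := by
        refine ⟨h2a, ?_⟩
        simp only [Function.comp_apply, Equiv.swap_apply_right,
          Equiv.swap_apply_of_ne_of_ne hac.symm hbc.symm]
        omega
      have x2 : IsAscent (α ∘ Equiv.swap b c) (a, b) := by
        refine ⟨h1a, ?_⟩
        simp only [Function.comp_apply, Equiv.swap_apply_left,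
          Equiv.swap_apply_of_ne_of_ne hab hac]
        omega
      have y1 : IsAscent ((α ∘ Equiv.swap a b) ∘ Equiv.swap b c) (a, b) := by
        refine ⟨h1a, ?_⟩
        simp only [Function.comp_apply, Equiv.swap_apply_left,
          Equiv.swap_apply_of_ne_of_ne hab hac,
          Equiv.swap_apply_of_ne_of_ne hac.symm hbc.symm]
        omega
      have y2 : IsAscent ((α ∘ Equiv.swap b c) ∘ Equiv.swap a b) (b, c) := by
        refine ⟨h2a, ?_⟩
        simp only [Function.comp_apply, Equiv.swap_apply_right,
          Equiv.swap_apply_of_ne_of_ne hab hac,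
          Equiv.swap_apply_of_ne_of_ne hac.symm hbc.symm]
        omega
      have v1 := weight_swap_lt x1
      have v2 := weight_swap_lt x2
      have hcomp : ((α ∘ Equiv.swap a b) ∘ Equiv.swap b c) ∘ Equiv.swap a b =
          ((α ∘ Equiv.swap b c) ∘ Equiv.swap a b) ∘ Equiv.swap b c := by
        funext z
        simp only [Function.comp_apply, Equiv.swap_apply_def]
        grind
      rw [ih _ w1 _ _ x1 rfl, ih _ (v1.trans w1) _ _ y1 rfl, ih _ w2 _ _ x2 rfl,
        ih _ (v2.trans w2) _ _ y2 rfl]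
      simp only
      rw [hcomp, isobaric_braid hab hbc hac]
    have hex : ∃ p, IsAscent α p := ⟨p, hp⟩
    have key : keyPoly R n α = isobaric hex.choose.1 hex.choose.2
        (keyPoly R n (α ∘ Equiv.swap hex.choose.1 hex.choose.2)) := by
      conv_lhs => rw [keyPoly]
      rw [dif_pos hex]
    rw [key]
    have hq := hex.choose_spec
    generalize hex.choose = q at hq
    obtain ⟨a, b⟩ := p
    obtain ⟨c, d⟩ := q
    by_cases hac : a = c
    · subst hac
      have : b = d := Fin.ext (by have := hp.1; have := hq.1; simp only at *; omega)
      rw [this]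
    by_cases hbc : b = c
    · subst hbc
      exact (braid _ _ _ hp hq).symm
    by_cases had : a = d
    · subst had
      exact braid _ _ _ hq hp
    have hbd : b ≠ d := fun h => hac (Fin.ext (by
      have h1 := hp.1; have h2 := hq.1; rw [h] at h1; simp only at h1 h2; omega))
    have hab : a ≠ b := fun h => by have := hp.1; simp [h] at this
    have hcd : c ≠ d := fun h => by have := hq.1; simp [h] at this
    have x1 : IsAscent (α ∘ Equiv.swap a b) (c, d) := by
      refine ⟨hq.1, ?_⟩
      simp only [Function.comp_apply, Equiv.swap_apply_of_ne_of_ne (Ne.symm hac) (Ne.symm hbc),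
        Equiv.swap_apply_of_ne_of_ne (Ne.symm had) (Ne.symm hbd)]
      exact hq.2
    have x2 : IsAscent (α ∘ Equiv.swap c d) (a, b) := by
      refine ⟨hp.1, ?_⟩
      simp only [Function.comp_apply, Equiv.swap_apply_of_ne_of_ne hac had,
        Equiv.swap_apply_of_ne_of_ne hbc hbd]
      exact hp.2
    have hcomp : (α ∘ Equiv.swap a b) ∘ Equiv.swap c d =
        (α ∘ Equiv.swap c d) ∘ Equiv.swap a b := by
      funext z
      simp only [Function.comp_apply, Equiv.swap_apply_def]
      grind
    simp only
    rw [ih _ (weight_swap_lt hq) _ _ x2 rfl, ih _ (weight_swap_lt hp) _ _ x1 rfl]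
    simp only
    rw [hcomp, isobaric_comm hab hcd hac had hbc hbd]

theorem isKeyFamily_keyPoly (n : ℕ) : IsKeyFamily R n (keyPoly R n) where
  of_antitone α hα := by
    rw [keyPoly, dif_neg (not_isAscent_of_antitone hα)]
  of_descent α i j hij hlt := by
    have h : IsAscent (α ∘ Equiv.swap i j) (i, j) := ⟨hij, by simpa using hlt⟩
    rw [keyPoly_of_ascent _ _ h]
    simp only
    rw [comp_swap_swap]

theorem IsKeyFamily.eq_keyPoly {n : ℕ} {K : (Fin n → ℕ) → MvPolynomial (Fin n) R}
    (hK : IsKeyFamily R n K) : K = keyPoly R n := by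
  funext α
  obtain ⟨N, hN⟩ : ∃ N, N = ∑ k : Fin n, (k : ℕ) * α k := ⟨_, rfl⟩
  induction N using Nat.strong_induction_on generalizing α with
  | _ N ih =>
    subst hN
    by_cases h : ∃ p, IsAscent α p
    · obtain ⟨p, hp⟩ := h
      rw [keyPoly_of_ascent α p hp, ← ih _ (weight_swap_lt hp) _ rfl,
        ← hK.of_descent _ _ _ hp.1 (by simpa using hp.2), comp_swap_swap]
    · rw [hK.of_antitone _ (antitone_of_not_isAscent h),
        (isKeyFamily_keyPoly n).of_antitone _ (antitone_of_not_isAscent h)]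

end KeyFamily

/-! ### Partitions and multi-symmetric Schur polynomials -/

/-- The set of all partitions. -/
abbrev Par : Type := Σ d : ℕ, Nat.Partition d

/-- The parts of a partition in weakly decreasing order, extended by zeros:
`part μ k` is `μ_{k+1}`. -/
def part (μ : Par) (k : ℕ) : ℕ :=
  (μ.2.parts.sort (· ≥ ·)).getD k 0

/-- The composition `(0^{n_1-ℓ(μ^{(1)})} * rev(μ^{(1)})) * ⋯ * (0^{n_r-ℓ(μ^{(r)})} * rev(μ^{(r)}))`
of length `n_1 + ⋯ + n_r` (meaningful when `n_i ≥ ℓ(μ^{(i)})` for all `i`). The equivalence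
`finSigmaFinEquiv` lists the positions of the first window, then those of the second one, and so
on; the entries of the `i`-th window are `μ^{(i)}_{n_i}, …, μ^{(i)}_2, μ^{(i)}_1`. -/
def windowComp {r : ℕ} (μ : Fin r → Par) (n : Fin r → ℕ) : Fin (∑ i, n i) → ℕ :=
  fun k =>
    let p := finSigmaFinEquiv.symm k
    part (μ p.1) (Fin.rev p.2)

/-- The multi-symmetric Schur polynomial: the key polynomial of `windowComp μ n` in the variables
`x_{1,1}, …, x_{1,n_1}, …, x_{r,1}, …, x_{r,n_r}`, where `x_{i+1,j+1}` is the variable `(i, j)`. -/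
def multiSchurPoly {r : ℕ} (μ : Fin r → Par) (n : Fin r → ℕ) : MvPolynomial (Fin r × ℕ) ℤ :=
  MvPolynomial.rename
    (fun k => ((finSigmaFinEquiv.symm k).1, ((finSigmaFinEquiv.symm k).2 : ℕ)))
    (keyPoly ℤ (∑ i, n i) (windowComp μ n))

/-- The multi-symmetric Schur function: the limit, as `n_1, …, n_r → ∞`, of the multi-symmetric
Schur polynomials in the ring of formal power series (coefficientwise convergence, the
coefficients being discrete). -/
def multiSchur {r : ℕ} (μ : Fin r → Par) : MvPowerSeries (Fin r × ℕ) ℤ :=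
  limUnder atTop fun n : Fin r → ℕ => (multiSchurPoly μ n : MvPowerSeries (Fin r × ℕ) ℤ)

/-! ### Rings of symmetric and multi-symmetric functions -/

/-- The ring `Λ_R(X)` of symmetric functions in `x_1, x_2, …`: the power series of bounded degree
that are invariant under all permutations of the variables. -/
def SymFun (R : Type*) [CommRing R] : Subalgebra R (MvPowerSeries ℕ R) where
  carrier := {f | (∀ w : Equiv.Perm ℕ, MvPowerSeries.rename w f = f) ∧
    ∃ d : ℕ, ∀ m : ℕ →₀ ℕ, MvPowerSeries.coeff m f ≠ 0 → m.degree ≤ d}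
  mul_mem' := by
    classical
    rintro f g ⟨hf, d, hd⟩ ⟨hg, e, he⟩
    refine ⟨fun w => by rw [map_mul, hf, hg], d + e, fun m hm => ?_⟩
    rw [MvPowerSeries.coeff_mul] at hm
    obtain ⟨p, hp, hne⟩ := Finset.exists_ne_zero_of_sum_ne_zero hm
    rw [← Finset.HasAntidiagonal.mem_antidiagonal.1 hp, map_add]
    exact add_le_add (hd _ (left_ne_zero_of_mul hne)) (he _ (right_ne_zero_of_mul hne))
  add_mem' := by
    rintro f g ⟨hf, d, hd⟩ ⟨hg, e, he⟩
    refine ⟨fun w => by rw [map_add, hf, hg], max d e, fun m hm => ?_⟩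
    by_cases h : MvPowerSeries.coeff m f = 0
    · exact le_max_of_le_right (he m fun h' => hm (by rw [map_add, h, h', add_zero]))
    · exact le_max_of_le_left (hd m h)
  algebraMap_mem' a := by
    classical
    refine ⟨fun w => AlgHom.commutes _ a, 0, fun m hm => ?_⟩
    rw [MvPowerSeries.algebraMap_apply, MvPowerSeries.coeff_C] at hm
    have : m = 0 := by
      by_contra h
      simp [h] at hm
    simp [this]

/-- The ring `Λ_R(X_1|⋯|X_r) = Λ_R(X_1) ⊗_R ⋯ ⊗_R Λ_R(X_r)` of multi-symmetric functions. -/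
abbrev MultiSymFun (R : Type*) [CommRing R] (r : ℕ) : Type _ :=
  ⨂[R] _i : Fin r, SymFun R

instance tendstoCofinite_prodMk {r : ℕ} (i : Fin r) :
    TendstoCofinite (fun j : ℕ => (i, j)) :=
  tendstoCofinite_of_injective (Prod.mk_right_injective i)

/-- Multi-symmetric functions as power series in the variables of all the `X_i`:
`f_1 ⊗ ⋯ ⊗ f_r ↦ f_1(X_1) ⋯ f_r(X_r)`. -/
def toPowerSeries (R : Type*) [CommRing R] (r : ℕ) :
    MultiSymFun R r →ₐ[R] MvPowerSeries (Fin r × ℕ) R :=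
  PiTensorProduct.liftAlgHom
    ((MultilinearMap.mkPiAlgebra R (Fin r) (MvPowerSeries (Fin r × ℕ) R)).compLinearMap
      fun i => ((MvPowerSeries.rename fun j : ℕ => (i, j)).comp (SymFun R).val).toLinearMap)
    (by simp)
    (fun f g => by simp [Finset.prod_mul_distrib])

end

end MultiSchur

/-!
Reversing each part of the concatenated composition makes the key polynomial weakly increasing on
every window, and `ξ_i f` is always symmetric in the variables `i` and `i + 1`; so the coefficients
of the polynomials depend only on the partitions formed by the rows of an exponent. The key
polynomial of a composition with vanishing entries specializes to the one without these entries when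
their variables are set to zero. Aligning the right ends of small and large windows, this identifies
the coefficients in both, and the limits exist. Products of monomial symmetric functions form a
basis of the multi-symmetric functions in which the coordinates are the coefficients at the
exponents with decreasing rows, whence injectivity. Finally `K_α` is `x^α` plus terms of smaller
rank, so the coordinates of the limits in this basis are unitriangular for a well-founded order.
-/

namespace MultiSchur

noncomputable section

/-! ### Isobaric divided differences -/

section Isobaric

open MvPolynomial (X)

variable {σ R : Type*} [DecidableEq σ] [CommRing R] [IsDomain R] {x y : σ}

theorem isobaric_eq_of_mul_eq (h : x ≠ y) {f g : MvPolynomial σ R}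
    (hg : (X x - X y) * g = X x * f - X y * swapVar x y f) : isobaric x y f = g :=
  mul_left_cancel₀ (X_sub_X_ne_zero (R := R) h) ((isobaric_spec x y f).trans hg.symm)

theorem isobaric_eq_self (h : x ≠ y) {f : MvPolynomial σ R} (hf : swapVar x y f = f) :
    isobaric x y f = f :=
  isobaric_eq_of_mul_eq h (by rw [hf, sub_mul])

theorem isobaric_add (h : x ≠ y) (f g : MvPolynomial σ R) :
    isobaric x y (f + g) = isobaric x y f + isobaric x y g := by
  apply isobaric_eq_of_mul_eq h
  rw [map_add]
  linear_combination isobaric_spec x y f + isobaric_spec x y g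

theorem isobaric_mul_of_swapVar_eq (h : x ≠ y) {g : MvPolynomial σ R} (hg : swapVar x y g = g)
    (f : MvPolynomial σ R) : isobaric x y (g * f) = g * isobaric x y f := by
  apply isobaric_eq_of_mul_eq h
  rw [map_mul, hg]
  linear_combination g * isobaric_spec x y f

/-- The isobaric divided difference as a linear map. -/
def isobaricLinearMap (h : x ≠ y) : MvPolynomial σ R →ₗ[R] MvPolynomial σ R where
  toFun := isobaric x y
  map_add' := isobaric_add h
  map_smul' a f := by
    rw [MvPolynomial.smul_eq_C_mul, RingHom.id_apply, MvPolynomial.smul_eq_C_mul]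
    exact isobaric_mul_of_swapVar_eq h (AlgHom.commutes _ a) f

theorem swapVar_isobaric_of_disjoint {a b c d : σ} (hcd : c ≠ d) (hac : a ≠ c) (had : a ≠ d)
    (hbc : b ≠ c) (hbd : b ≠ d) {f : MvPolynomial σ R} (hf : swapVar a b f = f) :
    swapVar a b (isobaric c d f) = isobaric c d f := by
  have hs : swapVar a b (swapVar c d f) = swapVar c d (swapVar a b f) := by
    have : (Equiv.swap a b : σ → σ) ∘ Equiv.swap c d = Equiv.swap c d ∘ Equiv.swap a b := by
      funext z
      grind
    simp only [swapVar, MvPolynomial.rename_rename, this]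
  have h := congrArg (swapVar a b) (isobaric_spec c d f)
  simp only [map_mul, map_sub, swapVar_X_of_ne hac.symm hbc.symm,
    swapVar_X_of_ne had.symm hbd.symm, hs, hf] at h
  exact (isobaric_eq_of_mul_eq hcd h).symm

theorem swapVar_isobaric_isobaric_left {a b c : σ} (hab : a ≠ b) (hbc : b ≠ c) (hac : a ≠ c)
    {f : MvPolynomial σ R} (hf : swapVar b c f = f) :
    swapVar a b (isobaric b c (isobaric a b f)) = isobaric b c (isobaric a b f) := by
  have hbraid := isobaric_braid hab hbc hac f
  rw [isobaric_eq_self hbc hf] at hbraid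
  rw [← hbraid, swapVar_isobaric hab]

theorem swapVar_isobaric_isobaric_right {a b c : σ} (hab : a ≠ b) (hbc : b ≠ c) (hac : a ≠ c)
    {f : MvPolynomial σ R} (hf : swapVar a b f = f) :
    swapVar b c (isobaric a b (isobaric b c f)) = isobaric a b (isobaric b c f) := by
  have hbraid := isobaric_braid hab hbc hac f
  rw [isobaric_eq_self hab hf] at hbraid
  rw [hbraid, swapVar_isobaric hbc]

end Isobaric

section Restriction

open MvPolynomial (X killCompl)

variable {σ τ R : Type*} [CommRing R] {e : σ → τ} (he : e.Injective)

theorem killCompl_X_apply (k : σ) : killCompl he (X (e k) : MvPolynomial τ R) = X k := by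
  rw [← MvPolynomial.rename_X, MvPolynomial.killCompl_rename_app]

theorem killCompl_X_of_notMem {t : τ} (ht : t ∉ Set.range e) :
    killCompl he (X t : MvPolynomial τ R) = 0 := by
  simp [killCompl, ht]

variable [DecidableEq τ]

theorem killCompl_swapVar [DecidableEq σ] (k l : σ) (f : MvPolynomial τ R) :
    killCompl he (swapVar (e k) (e l) f) = swapVar k l (killCompl he f) := by
  suffices H : (killCompl he).comp (swapVar (R := R) (e k) (e l)) =
      (swapVar k l).comp (killCompl he) from DFunLike.congr_fun H f
  refine MvPolynomial.algHom_ext fun z => ?_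
  simp only [AlgHom.comp_apply, swapVar, MvPolynomial.rename_X]
  by_cases hz : z ∈ Set.range e
  · obtain ⟨w, rfl⟩ := hz
    rw [he.swap_apply, killCompl_X_apply, killCompl_X_apply, MvPolynomial.rename_X]
  · rw [Equiv.swap_apply_of_ne_of_ne (fun h => hz ⟨k, h.symm⟩) (fun h => hz ⟨l, h.symm⟩),
      killCompl_X_of_notMem he hz, map_zero]

theorem killCompl_swapVar_eq_killCompl_comp (a b : τ) (f : MvPolynomial τ R) :
    killCompl he (swapVar a b f) = killCompl ((Equiv.swap a b).injective.comp he) f := by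
  suffices H : (killCompl he).comp (swapVar (R := R) a b) =
      killCompl ((Equiv.swap a b).injective.comp he) from DFunLike.congr_fun H f
  refine MvPolynomial.algHom_ext fun z => ?_
  simp only [AlgHom.comp_apply, swapVar, MvPolynomial.rename_X]
  obtain ⟨z, rfl⟩ := (Equiv.swap a b).surjective z
  rw [Equiv.swap_apply_self]
  by_cases hz : z ∈ Set.range e
  · obtain ⟨w, rfl⟩ := hz
    exact (killCompl_X_apply he w).trans (killCompl_X_apply _ w).symm
  · rw [killCompl_X_of_notMem he hz, killCompl_X_of_notMem]
    simpa using hz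

variable [IsDomain R]

theorem killCompl_isobaric [DecidableEq σ] {k l : σ} (h : k ≠ l) (f : MvPolynomial τ R) :
    killCompl he (isobaric (e k) (e l) f) = isobaric k l (killCompl he f) := by
  refine (isobaric_eq_of_mul_eq h ?_).symm
  simpa only [map_mul, map_sub, killCompl_X_apply, killCompl_swapVar] using
    congrArg (killCompl he) (isobaric_spec (e k) (e l) f)

/-- Setting `X a = 0` turns the defining quotient of `isobaric a (e l) f` into
`-X (e l) * swapVar a (e l) f / -X (e l)`. -/
theorem killCompl_isobaric_of_notMem {a : τ} (ha : a ∉ Set.range e) (l : σ)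
    (f : MvPolynomial τ R) :
    killCompl he (isobaric a (e l) f) =
      killCompl ((Equiv.swap a (e l)).injective.comp he) f := by
  have spec := congrArg (killCompl he) (isobaric_spec a (e l) f)
  simp only [map_mul, map_sub, killCompl_X_apply, killCompl_X_of_notMem he ha,
    killCompl_swapVar_eq_killCompl_comp] at spec
  refine mul_left_cancel₀ (MvPolynomial.X_ne_zero l) ?_
  linear_combination -spec

end Restriction

/-! ### Symmetry and restriction of key polynomials -/

section KeyPoly

variable {R : Type*} [CommRing R] [IsDomain R] {n : ℕ} {α : Fin n → ℕ} {i j : Fin n}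

theorem ne_of_val_succ (hij : (i : ℕ) + 1 = j) : i ≠ j := by
  rintro rfl
  omega

theorem ascent_induction {P : (Fin n → ℕ) → Prop} (antitone : ∀ α, Antitone α → P α)
    (swap : ∀ (α : Fin n → ℕ) (i j : Fin n), (i : ℕ) + 1 = j → α i < α j →
      P (α ∘ Equiv.swap i j) → P α) (α : Fin n → ℕ) : P α := by
  induction α using (measure fun α : Fin n → ℕ => ∑ k : Fin n, (k : ℕ) * α k).wf.induction with
  | _ α ih =>
    by_cases hex : ∃ p, IsAscent α p
    · obtain ⟨p, hp⟩ := hex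
      exact swap α p.1 p.2 hp.1 hp.2 (ih _ (weight_swap_lt hp))
    · exact antitone α (antitone_of_not_isAscent hex)

theorem keyPoly_eq_isobaric (hij : (i : ℕ) + 1 = j) (h : α i < α j) :
    keyPoly R n α = isobaric i j (keyPoly R n (α ∘ Equiv.swap i j)) :=
  keyPoly_of_ascent α (i, j) ⟨hij, h⟩

theorem swapVar_keyPoly_of_antitone (hα : Antitone α) (h : α i = α j) :
    swapVar i j (keyPoly R n α) = keyPoly R n α := by
  rw [(isKeyFamily_keyPoly n).of_antitone _ hα]
  simp only [swapVar, map_prod, map_pow, MvPolynomial.rename_X]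
  refine Fintype.prod_equiv (Equiv.swap i j) _ _ fun k => ?_
  congr 1
  grind

theorem swapVar_keyPoly_of_eq (hij : (i : ℕ) + 1 = j) (h : α i = α j) :
    swapVar i j (keyPoly R n α) = keyPoly R n α := by
  induction α using (measure fun α : Fin n → ℕ => ∑ k : Fin n, (k : ℕ) * α k).wf.induction
    generalizing i j with
  | _ α ih =>
    by_cases hex : ∃ p, IsAscent α p
    swap
    · exact swapVar_keyPoly_of_antitone (antitone_of_not_isAscent hex) h
    obtain ⟨⟨a, b⟩, hp⟩ := hex
    have hab : (a : ℕ) + 1 = b := hp.1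
    have hlt : α a < α b := hp.2
    have hne := ne_of_val_succ hij
    have hne' := ne_of_val_succ hab
    rw [keyPoly_eq_isobaric hab hlt]
    obtain rfl | hja := eq_or_ne j a
    · have hib : i ≠ b := Fin.ne_of_val_ne (by omega)
      have hp' : IsAscent (α ∘ Equiv.swap j b) (i, j) :=
        ⟨hij, by simpa [Equiv.swap_apply_of_ne_of_ne hne hib, h] using hlt⟩
      rw [keyPoly_eq_isobaric hp'.1 hp'.2]
      refine swapVar_isobaric_isobaric_left hne hne' hib
        (ih _ ((weight_swap_lt hp').trans (weight_swap_lt hp)) hab ?_)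
      simp [Equiv.swap_apply_of_ne_of_ne hib.symm hne'.symm,
        Equiv.swap_apply_of_ne_of_ne hne hib, h]
    obtain rfl | hbi := eq_or_ne b i
    · have haj : a ≠ j := Fin.ne_of_val_ne (by omega)
      have hp' : IsAscent (α ∘ Equiv.swap a b) (b, j) :=
        ⟨hij, by simpa [Equiv.swap_apply_of_ne_of_ne haj.symm hne.symm, ← h] using hlt⟩
      rw [keyPoly_eq_isobaric hp'.1 hp'.2]
      refine swapVar_isobaric_isobaric_right hne' hne haj
        (ih _ ((weight_swap_lt hp').trans (weight_swap_lt hp)) hab ?_)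
      simp [Equiv.swap_apply_of_ne_of_ne haj.symm hne.symm,
        Equiv.swap_apply_of_ne_of_ne hne' haj, h]
    have hia : i ≠ a := by
      rintro rfl
      exact hlt.ne (h.trans (congrArg α (Fin.ext (by omega))))
    have hjb : j ≠ b := fun hjb => hia (Fin.ext (by omega))
    refine swapVar_isobaric_of_disjoint hne' hia hbi.symm hja hjb
      (ih _ (weight_swap_lt hp) hij ?_)
    simpa [Equiv.swap_apply_of_ne_of_ne hia hbi.symm,
      Equiv.swap_apply_of_ne_of_ne hja hjb] using h

theorem swapVar_keyPoly (hij : (i : ℕ) + 1 = j) (h : α i ≤ α j) :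
    swapVar i j (keyPoly R n α) = keyPoly R n α := by
  obtain hlt | heq := h.lt_or_eq
  · rw [keyPoly_eq_isobaric hij hlt, swapVar_isobaric (ne_of_val_succ hij)]
  · exact swapVar_keyPoly_of_eq hij heq

theorem val_succ_of_strictMono {m : ℕ} {e : Fin m → Fin n} (he : StrictMono e) {k l : Fin m}
    (h : (e k : ℕ) + 1 = e l) : (k : ℕ) + 1 = l := by
  rw [← Nat.covBy_iff_add_one_eq, ← Fin.covBy_iff] at h ⊢
  exact h.of_image (OrderEmbedding.ofStrictMono e he)

theorem strictMono_swap_comp {m : ℕ} {e : Fin m → Fin n} (he : StrictMono e)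
    (hij : (i : ℕ) + 1 = j) (hi : i ∉ Set.range e) : StrictMono (Equiv.swap i j ∘ e) := by
  intro u v huv
  have huv := he huv
  have hu : e u ≠ i := fun h => hi ⟨u, h⟩
  have hv : e v ≠ i := fun h => hi ⟨v, h⟩
  grind

theorem killCompl_keyPoly_of_antitone {m : ℕ} {e : Fin m → Fin n} (he : StrictMono e)
    (hα : ∀ k ∉ Set.range e, α k = 0) (hanti : Antitone α) :
    MvPolynomial.killCompl he.injective (keyPoly R n α) = keyPoly R m (α ∘ e) := by
  rw [(isKeyFamily_keyPoly n).of_antitone _ hanti,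
    (isKeyFamily_keyPoly m).of_antitone _ (hanti.comp_monotone he.monotone), map_prod]
  refine (Fintype.prod_of_injective e he.injective _ _ (fun k hk => ?_) fun k => ?_).symm
  · rw [hα k hk, pow_zero, map_one]
  · rw [map_pow, killCompl_X_apply, Function.comp_apply]

theorem killCompl_keyPoly {m : ℕ} {e : Fin m → Fin n} (he : StrictMono e)
    (hα : ∀ k ∉ Set.range e, α k = 0) :
    MvPolynomial.killCompl he.injective (keyPoly R n α) = keyPoly R m (α ∘ e) := by
  induction α using ascent_induction generalizing e with
  | antitone α hanti => exact killCompl_keyPoly_of_antitone he hα hanti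
  | swap α i j hij hlt ih =>
    obtain ⟨l, rfl⟩ : j ∈ Set.range e := by
      by_contra hj
      simp [hα j hj] at hlt
    rw [keyPoly_eq_isobaric hij hlt]
    by_cases hi : i ∈ Set.range e
    · obtain ⟨k, rfl⟩ := hi
      have hkl := val_succ_of_strictMono he hij
      rw [killCompl_isobaric _ (ne_of_val_succ hkl), ih he,
        keyPoly_eq_isobaric (α := α ∘ e) hkl hlt]
      · congr 2
        funext z
        simp [he.injective.swap_apply]
      · grind
    · rw [killCompl_isobaric_of_notMem _ hi, ih (strictMono_swap_comp he hij hi)]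
      · congr 1
        funext z
        simp
      · grind

end KeyPoly

/-! ### Terms of isobaric divided differences -/

/-- `γ` is a possible exponent of a monomial of `isobaric x y` applied to `X ^ β`: it differs from
`β` at most at `x` and `y`, where the sum is preserved and the two values move towards each
other (or are interchanged). -/
structure IsTerm {σ : Type*} (x y : σ) (β γ : σ → ℕ) : Prop where
  eq_of_ne : ∀ z, z ≠ x → z ≠ y → γ z = β z
  add_eq : γ x + γ y = β x + β y
  mem_uIcc : γ x ∈ Set.uIcc (β x) (β y)

variable {σ : Type*} {x y : σ}

theorem isTerm_add_single (h : x ≠ y) {ρ : σ →₀ ℕ} (hρ : ρ x = ρ y) {a b c d : ℕ}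
    (hsum : a + b = c + d) (ha : a ∈ Set.uIcc c d) :
    IsTerm x y ⇑(ρ + (Finsupp.single x c + Finsupp.single y d))
      ⇑(ρ + (Finsupp.single x a + Finsupp.single y b)) where
  eq_of_ne z hx hy := by simp [hx.symm, hy.symm]
  add_eq := by simp [h, h.symm]; omega
  mem_uIcc := by
    rw [Set.mem_uIcc] at ha ⊢
    simp [h, h.symm, hρ]
    omega

theorem IsTerm.exists_sum_comp_eq [Fintype σ] {M : Type*} [AddCommMonoid M] (hne : x ≠ y)
    {β γ : σ → ℕ} (h : IsTerm x y β γ) (f : ℕ → M) :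
    ∃ c, ∑ z, f (γ z) = f (γ x) + f (γ y) + c ∧ ∑ z, f (β z) = f (β x) + f (β y) + c := by
  classical
  refine ⟨∑ z ∈ {x, y}ᶜ, f (β z), ?_, ?_⟩ <;>
    rw [← Finset.sum_add_sum_compl {x, y}, Finset.sum_pair hne]
  congr 1
  refine Finset.sum_congr rfl fun z hz => ?_
  obtain ⟨hx, hy⟩ : z ≠ x ∧ z ≠ y := by simpa using hz
  rw [h.eq_of_ne z hx hy]

theorem IsTerm.sum_eq [Fintype σ] (hne : x ≠ y) {β γ : σ → ℕ} (h : IsTerm x y β γ) :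
    ∑ z, γ z = ∑ z, β z := by
  obtain ⟨c, hγ, hβ⟩ := h.exists_sum_comp_eq hne id
  simp only [id] at hγ hβ
  rw [hγ, hβ, h.add_eq]

theorem IsTerm.eq_or_eq_comp_swap_or_sum_sq_lt [Fintype σ] [DecidableEq σ] (hne : x ≠ y)
    {β γ : σ → ℕ} (h : IsTerm x y β γ) :
    γ = β ∨ γ = β ∘ Equiv.swap x y ∨ ∑ z, γ z ^ 2 < ∑ z, β z ^ 2 := by
  have hout := h.eq_of_ne
  have hadd := h.add_eq
  obtain hx | hx := eq_or_ne (γ x) (β x)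
  · left
    funext z
    by_cases z = x <;> by_cases z = y <;> grind
  obtain hy | hy := eq_or_ne (γ x) (β y)
  · right; left
    funext z
    by_cases z = x <;> by_cases z = y <;> grind
  right; right
  obtain ⟨c, hγ, hβ⟩ := h.exists_sum_comp_eq hne (· ^ 2)
  rw [hγ, hβ]
  obtain ⟨h1, h2⟩ | ⟨h1, h2⟩ := Set.mem_uIcc.1 h.mem_uIcc
  · nlinarith [h1.lt_of_ne hx.symm, h2.lt_of_ne hy]
  · nlinarith [h1.lt_of_ne hy.symm, h2.lt_of_ne hx]

section Terms

open MvPolynomial (X monomial restrictSupport)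

variable {R : Type*} [DecidableEq σ] [CommRing R]

theorem coe_mapDomain_swap {M : Type*} [AddCommMonoid M] (x y : σ) (β : σ →₀ M) :
    (β.mapDomain (Equiv.swap x y) : σ → M) = β ∘ Equiv.swap x y := by
  funext z
  rw [Finsupp.mapDomain_equiv_apply, Equiv.symm_swap, Function.comp_apply]

theorem mapDomain_swap_of_eq {ρ : σ →₀ ℕ} (h : ρ x = ρ y) :
    ρ.mapDomain (Equiv.swap x y) = ρ := by
  refine DFunLike.coe_injective ?_
  rw [coe_mapDomain_swap]
  grind

omit [DecidableEq σ] in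
theorem exists_eq_add_single_of_le (h : x ≠ y) {β : σ →₀ ℕ} (hle : β y ≤ β x) :
    ∃ (ρ : σ →₀ ℕ) (d : ℕ), ρ x = ρ y ∧
      β = ρ + (Finsupp.single x d + Finsupp.single y 0) := by
  refine ⟨β - Finsupp.single x (β x - β y), β x - β y, ?_, ?_⟩
  · simp [h, Nat.sub_sub_self hle]
  · rw [Finsupp.single_zero, add_zero, tsub_add_cancel_of_le]
    exact Finsupp.single_le_iff.2 (Nat.sub_le _ _)

omit [DecidableEq σ] in
theorem monomial_mul_X_pow_mul_X_pow (x y : σ) (ρ : σ →₀ ℕ) (a b : ℕ) :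
    monomial ρ (1 : R) * (X x ^ a * X y ^ b) =
      monomial (ρ + (Finsupp.single x a + Finsupp.single y b)) 1 := by
  simp only [MvPolynomial.X_pow_eq_monomial, MvPolynomial.monomial_mul, one_mul]

variable [IsDomain R]

theorem isobaric_X_pow_left (h : x ≠ y) (d : ℕ) :
    isobaric x y (X x ^ d : MvPolynomial σ R) =
      ∑ k ∈ Finset.range (d + 1), X x ^ k * X y ^ (d - k) := by
  apply isobaric_eq_of_mul_eq h
  rw [map_pow, swapVar_X_left, ← pow_succ', ← pow_succ']
  exact (Commute.all _ _).mul_geom_sum₂ (d + 1)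

theorem isobaric_X_pow_right (h : x ≠ y) (d : ℕ) :
    isobaric x y (X y ^ (d + 1) : MvPolynomial σ R) =
      -∑ k ∈ Finset.range d, X x ^ (k + 1) * X y ^ (d - k) := by
  have hsum : ∑ k ∈ Finset.range d, (X x ^ (k + 1) * X y ^ (d - k) : MvPolynomial σ R) =
      X x * X y * ∑ k ∈ Finset.range d, X x ^ k * X y ^ (d - 1 - k) := by
    rw [Finset.mul_sum]
    refine Finset.sum_congr rfl fun k hk => ?_
    rw [show d - k = d - 1 - k + 1 by grind]
    ring
  apply isobaric_eq_of_mul_eq h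
  rw [map_pow, swapVar_X_right, hsum]
  linear_combination -(X x * X y) * (Commute.all (X x : MvPolynomial σ R) (X y)).mul_geom_sum₂ d

theorem isobaric_monomial_mul_of_eq (h : x ≠ y) {ρ : σ →₀ ℕ} (hρ : ρ x = ρ y)
    (f : MvPolynomial σ R) :
    isobaric x y (monomial ρ 1 * f) = monomial ρ 1 * isobaric x y f := by
  refine isobaric_mul_of_swapVar_eq h ?_ f
  rw [swapVar, MvPolynomial.rename_monomial, mapDomain_swap_of_eq hρ]

theorem isobaric_monomial_left (h : x ≠ y) {ρ : σ →₀ ℕ} (hρ : ρ x = ρ y) (d : ℕ) :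
    isobaric x y (monomial (ρ + (Finsupp.single x d + Finsupp.single y 0)) (1 : R)) =
      ∑ k ∈ Finset.range (d + 1),
        monomial (ρ + (Finsupp.single x k + Finsupp.single y (d - k))) 1 := by
  rw [← monomial_mul_X_pow_mul_X_pow, pow_zero, mul_one, isobaric_monomial_mul_of_eq h hρ,
    isobaric_X_pow_left h, Finset.mul_sum]
  simp only [monomial_mul_X_pow_mul_X_pow]

theorem isobaric_monomial_right (h : x ≠ y) {ρ : σ →₀ ℕ} (hρ : ρ x = ρ y) (d : ℕ) :
    isobaric x y (monomial (ρ + (Finsupp.single x 0 + Finsupp.single y (d + 1))) (1 : R)) =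
      -∑ k ∈ Finset.range d,
        monomial (ρ + (Finsupp.single x (k + 1) + Finsupp.single y (d - k))) 1 := by
  rw [← monomial_mul_X_pow_mul_X_pow, pow_zero, one_mul, isobaric_monomial_mul_of_eq h hρ,
    isobaric_X_pow_right h, mul_neg, Finset.mul_sum]
  simp only [monomial_mul_X_pow_mul_X_pow]

theorem isobaric_monomial_mem (h : x ≠ y) (β : σ →₀ ℕ) :
    isobaric x y (monomial β (1 : R)) ∈ restrictSupport R {γ | IsTerm x y β γ} := by
  obtain hle | hlt := le_or_gt (β y) (β x)
  · obtain ⟨ρ, d, hρ, rfl⟩ := exists_eq_add_single_of_le h hle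
    rw [isobaric_monomial_left h hρ]
    refine Submodule.sum_mem _ fun k hk =>
      (MvPolynomial.monomial_mem_restrictSupport R).2 (Or.inl ?_)
    exact isTerm_add_single h hρ (by grind) (by rw [Set.mem_uIcc]; grind)
  · obtain ⟨ρ, d, hρ, rfl⟩ := exists_eq_add_single_of_le h.symm hlt.le
    obtain ⟨d, rfl⟩ : ∃ d', d = d' + 1 := Nat.exists_eq_succ_of_ne_zero fun hd => by
      simp [hd, hρ] at hlt
    rw [add_comm (Finsupp.single y _), isobaric_monomial_right h hρ.symm]
    refine Submodule.neg_mem _ (Submodule.sum_mem _ fun k hk =>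
      (MvPolynomial.monomial_mem_restrictSupport R).2 (Or.inl ?_))
    exact isTerm_add_single h hρ.symm (by grind) (by rw [Set.mem_uIcc]; grind)

theorem isobaric_monomial_sub_mem_of_le (h : x ≠ y) {β : σ →₀ ℕ} (hle : β y ≤ β x) :
    isobaric x y (monomial β (1 : R)) - monomial (β.mapDomain (Equiv.swap x y)) 1 ∈
      restrictSupport R {γ | IsTerm x y β γ ∧ γ ≠ β.mapDomain (Equiv.swap x y)} := by
  obtain ⟨ρ, d, hρ, rfl⟩ := exists_eq_add_single_of_le h hle
  have hswap : (ρ + (Finsupp.single x d + Finsupp.single y 0)).mapDomain (Equiv.swap x y) =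
      ρ + (Finsupp.single x 0 + Finsupp.single y (d - 0)) := by
    simp [Finsupp.mapDomain_add, mapDomain_swap_of_eq hρ]
  rw [hswap, isobaric_monomial_left h hρ, Finset.sum_range_succ', add_sub_cancel_right]
  refine Submodule.sum_mem _ fun k hk =>
    (MvPolynomial.monomial_mem_restrictSupport R).2 (Or.inl ⟨?_, ?_⟩)
  · exact isTerm_add_single h hρ (by grind) (by rw [Set.mem_uIcc]; grind)
  · intro heq
    simpa [h, h.symm] using DFunLike.congr_fun heq x

theorem isobaric_mem_restrictSupport (h : x ≠ y) {s t : Set (σ →₀ ℕ)}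
    (hst : ∀ β ∈ s, ∀ γ : σ →₀ ℕ, IsTerm x y β γ → γ ∈ t) {f : MvPolynomial σ R}
    (hf : f ∈ restrictSupport R s) : isobaric x y f ∈ restrictSupport R t := by
  suffices restrictSupport R s ≤ (restrictSupport R t).comap (isobaricLinearMap h) from this hf
  rw [MvPolynomial.restrictSupport_eq_span, Submodule.span_le]
  rintro _ ⟨β, hβ, rfl⟩
  exact MvPolynomial.restrictSupport_mono R (hst β hβ) (isobaric_monomial_mem h β)

end Terms

/-! ### The leading monomial of a key polynomial -/

section LeadingMonomial

variable {n : ℕ}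

/-- The pairs of (not necessarily adjacent) positions at which `α` increases. -/
def ascents (α : Fin n → ℕ) : Finset (Fin n × Fin n) :=
  {p | p.1 < p.2 ∧ α p.1 < α p.2}

/-- The rank of an exponent: first the spread of its entries, measured by their sum of squares,
then the number of its ascents, i.e. the distance from being weakly decreasing. -/
def rank (α : Fin n → ℕ) : ℕ ×ₗ ℕ := toLex (∑ k, α k ^ 2, (ascents α).card)

theorem card_erase_ascents_comp_swap {i j : Fin n} (hij : (i : ℕ) + 1 = j) (α : Fin n → ℕ) :
    ((ascents (α ∘ Equiv.swap i j)).erase (i, j)).card = ((ascents α).erase (i, j)).card := by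
  have hmap (β : Fin n → ℕ) (p : Fin n × Fin n)
      (hp : p ∈ (ascents (β ∘ Equiv.swap i j)).erase (i, j)) :
      p.map (Equiv.swap i j) (Equiv.swap i j) ∈ (ascents β).erase (i, j) := by
    obtain ⟨k, l⟩ := p
    simp only [ascents, Finset.mem_erase, Finset.mem_filter_univ, Prod.map, ne_eq, Prod.mk.injEq,
      Function.comp_apply] at hp ⊢
    refine ⟨by grind, ?_, hp.2.2⟩
    grind
  refine Finset.card_nbij' (Prod.map (Equiv.swap i j) (Equiv.swap i j))
    (Prod.map (Equiv.swap i j) (Equiv.swap i j)) (hmap α) (fun p hp => hmap _ p ?_)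
    (fun p _ => by ext <;> simp) (fun p _ => by ext <;> simp)
  rwa [comp_swap_swap]

theorem card_ascents_comp_swap_of_lt {i j : Fin n} (hij : (i : ℕ) + 1 = j) {α : Fin n → ℕ}
    (h : α j < α i) : (ascents (α ∘ Equiv.swap i j)).card = (ascents α).card + 1 := by
  have hmem : (i, j) ∈ ascents (α ∘ Equiv.swap i j) := by
    simp only [ascents, Finset.mem_filter_univ, Function.comp_apply, Equiv.swap_apply_left,
      Equiv.swap_apply_right]
    exact ⟨Fin.lt_def.2 (by omega), h⟩
  have hnot : (i, j) ∉ ascents α := by simp [ascents, h.le]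
  rw [← Finset.card_erase_add_one hmem, card_erase_ascents_comp_swap hij,
    Finset.erase_eq_of_notMem hnot]

theorem card_ascents_comp_swap_le {i j : Fin n} (hij : (i : ℕ) + 1 = j) (α : Fin n → ℕ) :
    (ascents (α ∘ Equiv.swap i j)).card ≤ (ascents α).card + 1 := by
  have h := Finset.pred_card_le_card_erase (s := ascents (α ∘ Equiv.swap i j)) (a := (i, j))
  rw [card_erase_ascents_comp_swap hij] at h
  have := Finset.card_erase_le (s := ascents α) (a := (i, j))
  omega

theorem rank_lt_rank_comp_swap {i j : Fin n} (hij : (i : ℕ) + 1 = j) {α : Fin n → ℕ}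
    (h : α j < α i) : rank α < rank (α ∘ Equiv.swap i j) := by
  refine Prod.Lex.toLex_lt_toLex.2 (Or.inr ⟨?_, ?_⟩)
  · exact (Equiv.sum_comp (Equiv.swap i j) fun k => α k ^ 2).symm
  · simp [card_ascents_comp_swap_of_lt hij h]

theorem rank_comp_swap_lt_rank_comp_swap {i j : Fin n} (hij : (i : ℕ) + 1 = j) {α β : Fin n → ℕ}
    (h : α j < α i) (hβ : rank β < rank α) :
    rank (β ∘ Equiv.swap i j) < rank (α ∘ Equiv.swap i j) := by
  have hsq (γ : Fin n → ℕ) : ∑ k, (γ ∘ Equiv.swap i j) k ^ 2 = ∑ k, γ k ^ 2 :=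
    Equiv.sum_comp (Equiv.swap i j) fun k => γ k ^ 2
  have hle := card_ascents_comp_swap_le hij β
  simp only [rank, Prod.Lex.toLex_lt_toLex, hsq, card_ascents_comp_swap_of_lt hij h] at hβ ⊢
  omega

theorem IsTerm.rank_lt {i j : Fin n} (hij : (i : ℕ) + 1 = j) {α β γ : Fin n → ℕ} (h : α j < α i)
    (hβ : rank β < rank α) (hγ : IsTerm i j β γ) : rank γ < rank (α ∘ Equiv.swap i j) := by
  obtain rfl | rfl | hlt := hγ.eq_or_eq_comp_swap_or_sum_sq_lt (ne_of_val_succ hij)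
  · exact hβ.trans (rank_lt_rank_comp_swap hij h)
  · exact rank_comp_swap_lt_rank_comp_swap hij h hβ
  · exact (Prod.Lex.toLex_lt_toLex.2 (Or.inl hlt)).trans
      (hβ.trans (rank_lt_rank_comp_swap hij h))

theorem IsTerm.rank_lt_of_ne {i j : Fin n} (hij : (i : ℕ) + 1 = j) {α γ : Fin n → ℕ}
    (h : α j < α i) (hγ : IsTerm i j α γ) (hne : γ ≠ α ∘ Equiv.swap i j) :
    rank γ < rank (α ∘ Equiv.swap i j) := by
  obtain rfl | rfl | hlt := hγ.eq_or_eq_comp_swap_or_sum_sq_lt (ne_of_val_succ hij)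
  · exact rank_lt_rank_comp_swap hij h
  · exact absurd rfl hne
  · exact (Prod.Lex.toLex_lt_toLex.2 (Or.inl hlt)).trans (rank_lt_rank_comp_swap hij h)

variable {R : Type*} [CommRing R] [IsDomain R]

theorem keyPoly_of_antitone {α : Fin n →₀ ℕ} (hα : Antitone α) :
    keyPoly R n α = MvPolynomial.monomial α 1 := by
  rw [(isKeyFamily_keyPoly n).of_antitone _ hα, MvPolynomial.monomial_eq,
    Finsupp.prod_fintype _ _ fun _ => pow_zero _, map_one, one_mul]

theorem keyPoly_sub_monomial_mem (α : Fin n →₀ ℕ) :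
    keyPoly R n α - MvPolynomial.monomial α 1 ∈
      MvPolynomial.restrictSupport R {β | β.degree = α.degree ∧ rank β < rank α} := by
  induction hf : (α : Fin n → ℕ) using ascent_induction generalizing α with
  | antitone f hanti =>
    subst hf
    rw [keyPoly_of_antitone hanti, sub_self]
    exact Submodule.zero_mem _
  | swap f i j hij hlt ih =>
    subst hf
    have hne := ne_of_val_succ hij
    obtain ⟨δ, rfl⟩ := Finsupp.mapDomain_surjective (M := ℕ) (Equiv.swap i j).surjective α
    rw [coe_mapDomain_swap, comp_swap_swap] at ih
    specialize ih δ rfl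
    have hδ : δ j < δ i := by simpa [coe_mapDomain_swap] using hlt
    have hdeg {β γ : Fin n →₀ ℕ} (h : IsTerm i j β γ) : γ.degree = β.degree := by
      simpa only [Finsupp.degree_eq_sum] using h.sum_eq hne
    rw [keyPoly_eq_isobaric hij hlt, coe_mapDomain_swap, comp_swap_swap, Finsupp.degree_mapDomain,
      ← add_sub_cancel (MvPolynomial.monomial δ 1) (keyPoly R n δ), isobaric_add hne,
      add_sub_right_comm]
    refine Submodule.add_mem _ (MvPolynomial.restrictSupport_mono R ?_
      (isobaric_monomial_sub_mem_of_le hne hδ.le)) (isobaric_mem_restrictSupport hne ?_ ih)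
    · rintro γ ⟨hγ, hγδ⟩
      refine ⟨hdeg hγ, hγ.rank_lt_of_ne hij hδ fun h => hγδ (DFunLike.coe_injective ?_)⟩
      rw [h, coe_mapDomain_swap]
    · exact fun β hβ γ hγ => ⟨(hdeg hγ).trans hβ.1, hγ.rank_lt hij hδ hβ.2⟩

theorem coeff_keyPoly_self (α : Fin n →₀ ℕ) : (keyPoly R n α).coeff α = 1 := by
  have h := (MvPolynomial.mem_restrictSupport_iff R).1 (keyPoly_sub_monomial_mem α)
  by_contra hne
  have hα : α ∈ (keyPoly R n α - MvPolynomial.monomial α 1).support := by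
    rwa [MvPolynomial.mem_support_iff, MvPolynomial.coeff_sub, MvPolynomial.coeff_monomial,
      if_pos rfl, sub_ne_zero]
  exact lt_irrefl _ (h hα).2

theorem degree_eq_and_rank_lt_of_coeff_keyPoly_ne_zero {α β : Fin n →₀ ℕ} (hne : β ≠ α)
    (h : (keyPoly R n α).coeff β ≠ 0) : β.degree = α.degree ∧ rank β < rank α := by
  refine (MvPolynomial.mem_restrictSupport_iff R).1 (keyPoly_sub_monomial_mem α) ?_
  rwa [Finset.mem_coe, MvPolynomial.mem_support_iff, MvPolynomial.coeff_sub,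
    MvPolynomial.coeff_monomial, if_neg hne.symm, sub_zero]

end LeadingMonomial

/-! ### Partitions and exponents -/

section Partitions

theorem Par.ext_parts {μ ν : Par} (h : μ.2.parts = ν.2.parts) : μ = ν := by
  obtain ⟨d, p, hp, rfl⟩ := μ
  obtain ⟨e, q, hq, rfl⟩ := ν
  subst h
  rfl

/-- The number of parts of a partition, `ℓ(μ)` in the paper. -/
def Par.length (μ : Par) : ℕ := Multiset.card μ.2.parts

theorem Par.length_le_size (μ : Par) : μ.length ≤ μ.1 := by
  have := Multiset.card_nsmul_le_sum (s := μ.2.parts) (a := 1) fun _ hx => μ.2.parts_pos hx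
  rwa [μ.2.parts_sum, smul_eq_mul, mul_one] at this

theorem length_sort_parts (μ : Par) : (μ.2.parts.sort (· ≥ ·)).length = μ.length :=
  Multiset.length_sort _

theorem part_eq_zero_of_length_le {μ : Par} {k : ℕ} (h : μ.length ≤ k) : part μ k = 0 :=
  List.getD_eq_default _ _ ((length_sort_parts μ).trans_le h)

theorem map_part_range (μ : Par) :
    (List.range μ.length).map (part μ) = μ.2.parts.sort (· ≥ ·) := by
  refine List.ext_getElem (by simp [Par.length]) fun k _ hk => ?_
  rw [List.getElem_map, List.getElem_range]
  exact List.getD_eq_getElem _ _ hk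

theorem part_ne_zero_iff {μ : Par} {k : ℕ} : part μ k ≠ 0 ↔ k < μ.length := by
  refine ⟨fun h => not_le.1 (mt part_eq_zero_of_length_le h), fun h => ?_⟩
  have hmem : part μ k ∈ μ.2.parts.sort (· ≥ ·) := by
    rw [← map_part_range]
    exact List.mem_map_of_mem (List.mem_range.2 h)
  exact (μ.2.parts_pos ((Multiset.mem_sort _).1 hmem)).ne'

theorem part_antitone (μ : Par) : Antitone (part μ) := by
  refine antitone_nat_of_succ_le fun k => ?_
  by_cases hk : k + 1 < μ.length
  · have hsorted := μ.2.parts.pairwise_sort (· ≥ ·)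
    rw [← map_part_range, List.pairwise_map] at hsorted
    have h := List.pairwise_iff_getElem.1 hsorted k (k + 1) (by simp; omega) (by simpa)
      k.lt_succ_self
    rwa [List.getElem_range, List.getElem_range] at h
  · rw [part_eq_zero_of_length_le (not_lt.1 hk)]
    exact Nat.zero_le _

/-- A partition as the exponent `(μ_1, μ_2, …)`. -/
def partFinsupp (μ : Par) : ℕ →₀ ℕ where
  toFun := part μ
  support := Finset.range μ.length
  mem_support_toFun _ := Finset.mem_range.trans part_ne_zero_iff.symm

@[simp]
theorem partFinsupp_apply (μ : Par) (k : ℕ) : partFinsupp μ k = part μ k := rfl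

/-- The partition formed by the nonzero values of an exponent. -/
def ofFinsupp {σ : Type*} (m : σ →₀ ℕ) : Par where
  fst := m.degree
  snd :=
    { parts := m.support.val.map m
      parts_pos h := by
        obtain ⟨k, hk, rfl⟩ := Multiset.mem_map.1 h
        exact Nat.pos_of_ne_zero (Finsupp.mem_support_iff.1 hk)
      parts_sum := rfl }

theorem ofFinsupp_mapDomain {σ τ : Type*} {e : σ → τ} (he : e.Injective) (m : σ →₀ ℕ) :
    ofFinsupp (m.mapDomain e) = ofFinsupp m := by
  classical
  apply Par.ext_parts
  change Multiset.map (m.mapDomain e) (m.mapDomain e).support.val = m.support.val.map m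
  rw [Finsupp.mapDomain_support_of_injective he, Finset.image_val_of_injOn he.injOn,
    Multiset.map_map]
  exact Multiset.map_congr rfl fun k _ => Finsupp.mapDomain_apply he _ _

theorem length_ofFinsupp {σ : Type*} (m : σ →₀ ℕ) :
    (ofFinsupp m).length = m.support.card :=
  Multiset.card_map _ _

theorem ofFinsupp_partFinsupp (μ : Par) : ofFinsupp (partFinsupp μ) = μ := by
  apply Par.ext_parts
  change Multiset.map (part μ) (Finset.range μ.length).val = μ.2.parts
  rw [Finset.range_val, ← Multiset.coe_range, Multiset.map_coe, map_part_range, Multiset.sort_eq]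

theorem degree_partFinsupp (μ : Par) : (partFinsupp μ).degree = μ.1 :=
  congrArg Sigma.fst (ofFinsupp_partFinsupp μ)

theorem support_eq_range_of_antitone {m : ℕ →₀ ℕ} (hm : Antitone m) :
    m.support = Finset.range m.support.card := by
  have hlower : IsLowerSet (m.support : Set ℕ) := fun k l hlk hk => by
    simp only [Finset.mem_coe, Finsupp.mem_support_iff] at hk ⊢
    have := hm hlk
    omega
  obtain huniv | ⟨N, hN⟩ := hlower.eq_univ_or_Iio
  · exact absurd (huniv ▸ m.support.finite_toSet) Set.infinite_univ
  · have hN : m.support = Finset.range N := Finset.coe_injective (by rw [hN, Finset.coe_range])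
    rw [hN, Finset.card_range]

theorem partFinsupp_ofFinsupp {m : ℕ →₀ ℕ} (hm : Antitone m) :
    partFinsupp (ofFinsupp m) = m := by
  have hsupp := support_eq_range_of_antitone hm
  have hsort : (ofFinsupp m).2.parts.sort (· ≥ ·) = (List.range m.support.card).map m := by
    refine List.Perm.eq_of_pairwise' (Multiset.pairwise_sort _ _) ?_ ?_
    · exact List.pairwise_map.2 (List.pairwise_le_range.imp fun h => hm h)
    · rw [← Multiset.coe_eq_coe, Multiset.sort_eq, ← Multiset.map_coe, Multiset.coe_range,
        ← Finset.range_val, ← hsupp]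
      rfl
  rw [← map_part_range, length_ofFinsupp, List.map_inj_left] at hsort
  ext k
  by_cases hk : k < m.support.card
  · exact hsort k (List.mem_range.2 hk)
  · rw [partFinsupp_apply, part_eq_zero_of_length_le ((length_ofFinsupp m).trans_le (not_lt.1 hk)),
      eq_comm, ← Finsupp.notMem_support_iff, hsupp, Finset.mem_range]
    exact hk

end Partitions

/-! ### Sorting exponents -/

section Sorting

variable {σ : Type*} [DecidableEq σ]

theorem weight_mapDomain_swap_lt {h : σ → ℕ} {x y : σ} (hxy : h x < h y) {m : σ →₀ ℕ}
    (hm : m x < m y) : Finsupp.weight h (m.mapDomain (Equiv.swap x y)) < Finsupp.weight h m := by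
  have hne : x ≠ y := ne_of_apply_ne h hxy.ne
  obtain ⟨ρ, d, hρ, rfl⟩ := exists_eq_add_single_of_le hne.symm hm.le
  have hd : 0 < d := by simpa [hne, hne.symm, hρ] using hm
  simpa [Finsupp.mapDomain_add, mapDomain_swap_of_eq hρ.symm, Finsupp.weight_single] using
    Nat.mul_lt_mul_of_pos_left hxy hd

theorem sort_induction {r : σ → σ → Prop} {h : σ → ℕ} (hr : ∀ x y, r x y → h x < h y)
    {P : (σ →₀ ℕ) → Prop} (sorted : ∀ m, (∀ x y, r x y → m y ≤ m x) → P m)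
    (swap : ∀ m x y, r x y → m x < m y → P (m.mapDomain (Equiv.swap x y)) → P m)
    (m : σ →₀ ℕ) : P m := by
  induction m using (measure fun m : σ →₀ ℕ => Finsupp.weight h m).wf.induction with
  | _ m ih =>
    by_cases hex : ∃ x y, r x y ∧ m x < m y
    · obtain ⟨x, y, hxy, hm⟩ := hex
      exact swap m x y hxy hm (ih _ (weight_mapDomain_swap_lt (hr x y hxy) hm))
    · push Not at hex
      exact sorted m hex

end Sorting

section Rows

variable {ι : Type*}

/-- The partitions formed by the rows of an exponent. -/
def rowPar (m : ι × ℕ →₀ ℕ) (i : ι) : Par := ofFinsupp (m.curry i)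

theorem rowPar_mapDomain_prodShear (m : ι × ℕ →₀ ℕ) (w : ι → Equiv.Perm ℕ) :
    rowPar (m.mapDomain (Equiv.prodShear (Equiv.refl ι) w)) = rowPar m := by
  funext i
  rw [rowPar, rowPar, ← ofFinsupp_mapDomain (w i).injective (m.curry i)]
  congr 1
  ext j
  rw [Finsupp.curry_apply, Finsupp.mapDomain_equiv_apply, Finsupp.mapDomain_equiv_apply,
    Finsupp.curry_apply]
  rfl

theorem rowPar_mapDomain_swap [DecidableEq ι] (m : ι × ℕ →₀ ℕ) (i : ι) (j k : ℕ) :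
    rowPar (m.mapDomain (Equiv.swap (i, j) (i, k))) = rowPar m := by
  have hswap : Equiv.swap (i, j) (i, k) =
      Equiv.prodShear (Equiv.refl ι) (Function.update 1 i (Equiv.swap j k)) := by
    ext1 ⟨i', l⟩
    obtain rfl | hi := eq_or_ne i' i
    · simp [(Prod.mk_right_injective i').swap_apply]
    · simp [Equiv.swap_apply_of_ne_of_ne, hi]
  rw [hswap, rowPar_mapDomain_prodShear]

variable [Finite ι]

/-- The exponent whose rows are the given partitions. -/
def rowsFinsupp (μ : ι → Par) : ι × ℕ →₀ ℕ :=
  (Finsupp.equivFunOnFinite.symm fun i => partFinsupp (μ i)).uncurry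

@[simp]
theorem rowsFinsupp_apply (μ : ι → Par) (i : ι) (j : ℕ) :
    rowsFinsupp μ (i, j) = part (μ i) j := by
  simp [rowsFinsupp, Finsupp.uncurry_apply]

theorem rowPar_rowsFinsupp (μ : ι → Par) : rowPar (rowsFinsupp μ) = μ := by
  funext i
  have : (rowsFinsupp μ).curry i = partFinsupp (μ i) := by
    ext j
    simp [Finsupp.curry_apply]
  rw [rowPar, this, ofFinsupp_partFinsupp]

theorem rowsFinsupp_rowPar {m : ι × ℕ →₀ ℕ} (hm : ∀ i, Antitone fun j => m (i, j)) :
    rowsFinsupp (rowPar m) = m := by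
  ext ⟨i, j⟩
  have hanti : Antitone (m.curry i) := fun _ _ hjk => by
    simpa only [Finsupp.curry_apply] using hm i hjk
  rw [rowsFinsupp_apply, rowPar, ← partFinsupp_apply, partFinsupp_ofFinsupp hanti,
    Finsupp.curry_apply]

end Rows

/-! ### Monomial bases -/

section Monomial

variable {R : Type*} [CommRing R]

theorem coeff_mapDomain_rename {σ τ : Type*} {e : σ → τ} (he : e.Injective) [TendstoCofinite e]
    (f : MvPowerSeries σ R) (m : σ →₀ ℕ) :
    MvPowerSeries.coeff (m.mapDomain e) (MvPowerSeries.rename e f) = MvPowerSeries.coeff m f := by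
  have h := MvPowerSeries.coeff_embDomain_rename ⟨e, he⟩ f m
  rwa [Finsupp.embDomain_eq_mapDomain] at h

theorem coeff_symFun (f : SymFun R) (m : ℕ →₀ ℕ) :
    MvPowerSeries.coeff m (f : MvPowerSeries ℕ R) =
      MvPowerSeries.coeff (partFinsupp (ofFinsupp m)) (f : MvPowerSeries ℕ R) := by
  induction m using sort_induction (r := (· < ·)) (h := id) (fun _ _ h => h) with
  | sorted m hm =>
    have hanti : Antitone m := antitone_nat_of_succ_le fun k => hm _ _ k.lt_succ_self
    rw [partFinsupp_ofFinsupp hanti]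
  | swap m x y _ _ ih =>
    rwa [ofFinsupp_mapDomain (Equiv.injective _), ← f.2.1 (Equiv.swap x y),
      coeff_mapDomain_rename (Equiv.injective _), f.2.1] at ih

theorem finite_setOf_size_le (d : ℕ) : {μ : Par | μ.1 ≤ d}.Finite := by
  have h : {μ : Par | μ.1 ≤ d} ⊆ ⋃ e ∈ Set.Iic d, Set.range (Sigma.mk e) := by
    rintro ⟨e, p⟩ he
    exact Set.mem_biUnion he ⟨p, rfl⟩
  exact ((Set.finite_Iic d).biUnion fun _ _ => Set.finite_range _).subset h

/-- The symmetric function with prescribed coefficients at the partitions. -/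
def symFunOfCoeff (c : Par →₀ R) : SymFun R where
  val m := c (ofFinsupp m)
  property := by
    refine ⟨fun w => ?_, c.support.sup Sigma.fst, fun m hm => ?_⟩
    · ext m
      obtain ⟨m, rfl⟩ := Finsupp.mapDomain_surjective w.surjective m
      exact (coeff_mapDomain_rename w.injective _ m).trans
        (congrArg c (ofFinsupp_mapDomain w.injective m).symm)
    · exact Finset.le_sup (f := Sigma.fst) (Finsupp.mem_support_iff.2 hm)

theorem coeff_symFunOfCoeff (c : Par →₀ R) (m : ℕ →₀ ℕ) :
    MvPowerSeries.coeff m (symFunOfCoeff c : MvPowerSeries ℕ R) = c (ofFinsupp m) := rfl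

theorem exists_symFunOfCoeff_eq (f : SymFun R) : ∃ c, symFunOfCoeff c = f := by
  obtain ⟨d, hd⟩ := f.2.2
  refine ⟨Finsupp.onFinset (finite_setOf_size_le d).toFinset
    (fun μ => MvPowerSeries.coeff (partFinsupp μ) (f : MvPowerSeries ℕ R)) fun μ hμ => ?_, ?_⟩
  · simpa [degree_partFinsupp] using hd _ hμ
  · ext m
    rw [coeff_symFunOfCoeff, coeff_symFun f m, Finsupp.onFinset_apply]

/-- The basis of the ring of symmetric functions formed by the monomial symmetric functions. -/
def monomialBasis (R : Type*) [CommRing R] : Module.Basis Par R (SymFun R) :=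
  .ofRepr <| LinearEquiv.symm <| LinearEquiv.ofBijective
    { toFun := symFunOfCoeff
      map_add' := fun _ _ => rfl
      map_smul' := fun _ _ => rfl } <| by
    refine ⟨fun c c' h => Finsupp.ext fun μ => ?_, exists_symFunOfCoeff_eq⟩
    have hμ : c (ofFinsupp (partFinsupp μ)) = c' (ofFinsupp (partFinsupp μ)) :=
      congrArg (fun f : SymFun R => MvPowerSeries.coeff (partFinsupp μ) f.1) h
    rwa [ofFinsupp_partFinsupp] at hμ

theorem coeff_monomialBasis [DecidableEq Par] (μ : Par) (m : ℕ →₀ ℕ) :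
    MvPowerSeries.coeff m (monomialBasis R μ : MvPowerSeries ℕ R) =
      if ofFinsupp m = μ then 1 else 0 := by
  change (Finsupp.single μ (1 : R)) (ofFinsupp m) = _
  rw [Finsupp.single_apply]
  simp only [eq_comm]

end Monomial

section MultiMonomial

variable {R : Type*} [CommRing R] {r : ℕ}

theorem toPowerSeries_tprod (f : Fin r → SymFun R) :
    toPowerSeries R r (PiTensorProduct.tprod R f) =
      ∏ i, MvPowerSeries.rename (fun j : ℕ => (i, j)) (f i : MvPowerSeries ℕ R) := by
  simp [toPowerSeries, PiTensorProduct.liftAlgHom]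

theorem curry_sum_mapDomain {ι : Type*} [Fintype ι] (q : ι → ℕ →₀ ℕ) (i : ι) :
    (∑ i', (q i').mapDomain (Prod.mk i')).curry i = q i := by
  ext j
  rw [Finsupp.curry_apply, Finsupp.finsetSum_apply, Finset.sum_eq_single i]
  · exact Finsupp.mapDomain_apply (Prod.mk_right_injective i) _ _
  · rintro i' _ hi
    refine Finsupp.mapDomain_of_notMem_range _ _ ?_
    rintro ⟨k, hk⟩
    exact hi (congrArg Prod.fst hk)
  · simp

theorem sum_mapDomain_curry {ι : Type*} [Fintype ι] (m : ι × ℕ →₀ ℕ) :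
    ∑ i, (m.curry i).mapDomain (Prod.mk i) = m := by
  ext ⟨i, j⟩
  rw [← Finsupp.curry_apply, curry_sum_mapDomain, Finsupp.curry_apply]

theorem coeff_prod_rename (f : Fin r → MvPowerSeries ℕ R) (m : Fin r × ℕ →₀ ℕ) :
    MvPowerSeries.coeff m (∏ i, MvPowerSeries.rename (fun j : ℕ => (i, j)) (f i)) =
      ∏ i, MvPowerSeries.coeff (m.curry i) (f i) := by
  classical
  rw [MvPowerSeries.coeff_prod, Finset.sum_eq_single (Finsupp.equivFunOnFinite.symm
    fun i => (m.curry i).mapDomain (Prod.mk i))]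
  · exact Finset.prod_congr rfl fun i _ =>
      coeff_mapDomain_rename (Prod.mk_right_injective i) (f i) _
  · intro l hl hne
    by_contra hprod
    have hrow (i : Fin r) : ∃ q : ℕ →₀ ℕ, q.mapDomain (Prod.mk i) = l i := by
      by_contra hi
      exact hprod (Finset.prod_eq_zero (Finset.mem_univ i)
        (MvPowerSeries.coeff_rename_eq_zero _ _ (by simpa using hi)))
    choose q hq using hrow
    have hm : ∑ i, (q i).mapDomain (Prod.mk i) = m := by
      simpa only [hq] using (Finset.mem_finsuppAntidiag.1 hl).1
    refine hne (Finsupp.ext fun i => ?_)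
    rw [Finsupp.equivFunOnFinite_symm_apply_apply, ← hm, curry_sum_mapDomain, hq]
  · refine fun h => absurd (Finset.mem_finsuppAntidiag.2 ⟨?_, Finset.subset_univ _⟩) h
    simpa using sum_mapDomain_curry m

/-- The basis of the ring of multi-symmetric functions formed by the products of monomial
symmetric functions. -/
def multiMonomialBasis (R : Type*) [CommRing R] (r : ℕ) :
    Module.Basis (Fin r → Par) R (MultiSymFun R r) :=
  Basis.piTensorProduct fun _ => monomialBasis R

theorem coeff_toPowerSeries (t : MultiSymFun R r) (m : Fin r × ℕ →₀ ℕ) :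
    MvPowerSeries.coeff m (toPowerSeries R r t) = (multiMonomialBasis R r).repr t (rowPar m) := by
  classical
  suffices H : (MvPowerSeries.coeff m).comp (toPowerSeries R r).toLinearMap =
      (Finsupp.lapply (rowPar m)).comp (multiMonomialBasis R r).repr.toLinearMap from
    DFunLike.congr_fun H t
  refine (multiMonomialBasis R r).ext fun μ => ?_
  simp only [LinearMap.comp_apply, LinearEquiv.coe_coe, AlgHom.toLinearMap_apply,
    Module.Basis.repr_self, Finsupp.lapply_apply]
  rw [multiMonomialBasis, Basis.piTensorProduct_apply, toPowerSeries_tprod, coeff_prod_rename]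
  simp only [coeff_monomialBasis]
  rw [Finset.prod_boole, Finsupp.single_apply]
  congr 1
  simp [funext_iff, rowPar, eq_comm]

theorem toPowerSeries_injective : Function.Injective (toPowerSeries R r) := by
  intro t t' h
  refine (multiMonomialBasis R r).ext_elem fun μ => ?_
  have hμ := congrArg (MvPowerSeries.coeff (rowsFinsupp μ)) h
  rwa [coeff_toPowerSeries, coeff_toPowerSeries, rowPar_rowsFinsupp] at hμ

theorem exists_toPowerSeries_eq {F : MvPowerSeries (Fin r × ℕ) R}
    (hsymm : ∀ m, MvPowerSeries.coeff m F = MvPowerSeries.coeff (rowsFinsupp (rowPar m)) F)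
    (hfin : {μ | MvPowerSeries.coeff (rowsFinsupp μ) F ≠ 0}.Finite) :
    ∃ t, toPowerSeries R r t = F := by
  refine ⟨(multiMonomialBasis R r).repr.symm (Finsupp.onFinset hfin.toFinset
    (fun μ => MvPowerSeries.coeff (rowsFinsupp μ) F) fun μ hμ => by simpa using hμ), ?_⟩
  ext m
  rw [coeff_toPowerSeries, LinearEquiv.apply_symm_apply, Finsupp.onFinset_apply, ← hsymm]

end MultiMonomial

/-! ### Unitriangular families -/

section Unitriangular

variable {ι R M Γ : Type*} [CommRing R] [AddCommGroup M] [Module R M] [LinearOrder Γ]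
  {b : Module.Basis ι R M} {v : ι → M} {ρ : ι → Γ}

theorem linearIndependent_of_unitriangular (hdiag : ∀ i, b.repr (v i) i = 1)
    (hlt : ∀ i j, b.repr (v i) j ≠ 0 → j ≠ i → ρ j < ρ i) : LinearIndependent R v := by
  rw [linearIndependent_iff]
  intro l hl
  by_contra hne
  obtain ⟨i, hi, hmax⟩ := l.support.exists_max_image ρ (Finsupp.support_nonempty_iff.2 hne)
  have hcoeff (j : ι) (hj : j ∈ l.support) (hji : j ≠ i) : b.repr (v j) i = 0 := by
    by_contra h
    exact (hlt j i h hji.symm).not_ge (hmax j hj)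
  have h := congrArg (fun x => b.repr x i) hl
  simp only [Finsupp.linearCombination_apply, Finsupp.sum, map_sum, map_smul, map_zero,
    Finsupp.finsetSum_apply, Finsupp.smul_apply, Finsupp.zero_apply, smul_eq_mul] at h
  rw [Finset.sum_eq_single_of_mem i hi fun j hj hji => by rw [hcoeff j hj hji, mul_zero], hdiag,
    mul_one] at h
  exact Finsupp.mem_support_iff.1 hi h

theorem mem_span_of_unitriangular [WellFoundedLT Γ] (hdiag : ∀ i, b.repr (v i) i = 1)
    (hlt : ∀ i j, b.repr (v i) j ≠ 0 → j ≠ i → ρ j < ρ i) (i : ι) :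
    b i ∈ Submodule.span R (Set.range v) := by
  classical
  induction i using (InvImage.wf ρ wellFounded_lt).induction with
  | _ i ih =>
    have hv : b i + ((b.repr (v i)).erase i).sum (fun j a => a • b j) = v i := by
      have h := Finsupp.add_sum_erase' (b.repr (v i)) i (fun j a => a • b j)
        fun j => zero_smul R (b j)
      rwa [hdiag, one_smul, ← Finsupp.linearCombination_apply R (b.repr (v i)),
        b.linearCombination_repr] at h
    rw [eq_sub_of_add_eq hv]
    refine Submodule.sub_mem _ (Submodule.subset_span ⟨i, rfl⟩)
      (Submodule.sum_mem _ fun j hj => Submodule.smul_mem _ _ (ih j ?_))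
    rw [Finsupp.support_erase, Finset.mem_erase, Finsupp.mem_support_iff] at hj
    exact hlt i j hj.2 hj.1

theorem exists_basis_of_unitriangular [WellFoundedLT Γ] (hdiag : ∀ i, b.repr (v i) i = 1)
    (hlt : ∀ i j, b.repr (v i) j ≠ 0 → j ≠ i → ρ j < ρ i) :
    ∃ b' : Module.Basis ι R M, ∀ i, b' i = v i := by
  refine ⟨.mk (linearIndependent_of_unitriangular hdiag hlt) ?_, Module.Basis.mk_apply _ _⟩
  rw [← b.span_eq, Submodule.span_le, Set.range_subset_iff]
  exact mem_span_of_unitriangular hdiag hlt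

end Unitriangular

/-! ### Windows of variables -/

section Windows

variable {r : ℕ} {n n' : Fin r → ℕ} {μ ν : Fin r → Par}

theorem finSigmaFinEquiv_val (k : (i : Fin r) × Fin (n i)) :
    (finSigmaFinEquiv k : ℕ) = ∑ i ∈ Finset.Iio k.1, n i + k.2 := by
  rw [finSigmaFinEquiv_apply]
  congr 1
  refine Finset.sum_nbij (Fin.castLE k.1.2.le) (fun i _ => ?_)
    (Fin.castLE_injective k.1.2.le).injOn (fun i hi => ?_) fun _ _ => rfl
  · exact Finset.mem_Iio.2 (Fin.lt_def.2 i.2)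
  · exact ⟨⟨i, Fin.lt_def.1 (Finset.mem_Iio.1 (Finset.mem_coe.1 hi))⟩,
      Finset.mem_coe.2 (Finset.mem_univ _), rfl⟩

theorem finSigmaFinEquiv_lt_of_fst_lt {k l : (i : Fin r) × Fin (n i)} (h : k.1 < l.1) :
    finSigmaFinEquiv k < finSigmaFinEquiv l := by
  rw [Fin.lt_def, finSigmaFinEquiv_val, finSigmaFinEquiv_val]
  calc ∑ i ∈ Finset.Iio k.1, n i + k.2
      < ∑ i ∈ Finset.Iio k.1, n i + n k.1 := Nat.add_lt_add_left k.2.2 _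
    _ = ∑ i ∈ Finset.Iic k.1, n i := by
      rw [← Finset.Iio_insert, Finset.sum_insert (by simp), add_comm]
    _ ≤ ∑ i ∈ Finset.Iio l.1, n i :=
      Finset.sum_le_sum_of_subset fun i hi => Finset.mem_Iio.2 ((Finset.mem_Iic.1 hi).trans_lt h)
    _ ≤ ∑ i ∈ Finset.Iio l.1, n i + l.2 := Nat.le_add_right _ _

theorem finSigmaFinEquiv_lt_iff {i : Fin r} {j j' : Fin (n i)} :
    finSigmaFinEquiv ⟨i, j⟩ < finSigmaFinEquiv (⟨i, j'⟩ : (i : Fin r) × Fin (n i)) ↔ j < j' := by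
  rw [Fin.lt_def, finSigmaFinEquiv_val, finSigmaFinEquiv_val, Fin.lt_def]
  exact Nat.add_lt_add_iff_left

/-- The variable at a position of a composition cut into windows of the given sizes. -/
def windowVar (n : Fin r → ℕ) (k : Fin (∑ i, n i)) : Fin r × ℕ :=
  ((finSigmaFinEquiv.symm k).1, ((finSigmaFinEquiv.symm k).2 : ℕ))

theorem windowVar_finSigmaFinEquiv (i : Fin r) (j : Fin (n i)) :
    windowVar n (finSigmaFinEquiv ⟨i, j⟩) = (i, (j : ℕ)) :=
  congrArg (fun p : (i : Fin r) × Fin (n i) => (p.1, (p.2 : ℕ))) (Equiv.symm_apply_apply _ _)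

theorem windowVar_injective (n : Fin r → ℕ) : Function.Injective (windowVar n) := by
  intro k l h
  obtain ⟨⟨i, j⟩, rfl⟩ := finSigmaFinEquiv.surjective k
  obtain ⟨⟨i', j'⟩, rfl⟩ := finSigmaFinEquiv.surjective l
  rw [windowVar_finSigmaFinEquiv, windowVar_finSigmaFinEquiv, Prod.mk.injEq] at h
  obtain ⟨rfl, h⟩ := h
  rw [Fin.ext h]

theorem mem_range_windowVar {p : Fin r × ℕ} : p ∈ Set.range (windowVar n) ↔ p.2 < n p.1 := by
  constructor
  · rintro ⟨k, rfl⟩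
    exact (finSigmaFinEquiv.symm k).2.2
  · exact fun h => ⟨finSigmaFinEquiv ⟨p.1, ⟨p.2, h⟩⟩, windowVar_finSigmaFinEquiv _ _⟩

theorem windowComp_finSigmaFinEquiv (μ : Fin r → Par) (n : Fin r → ℕ) (i : Fin r) (j : Fin (n i)) :
    windowComp μ n (finSigmaFinEquiv ⟨i, j⟩) = part (μ i) j.rev :=
  congrArg (fun p : (i : Fin r) × Fin (n i) => part (μ p.1) p.2.rev) (Equiv.symm_apply_apply _ _)

/-- The exponents involving only the variables in windows of the given sizes. -/
def InWindows (n : Fin r → ℕ) (m : Fin r × ℕ →₀ ℕ) : Prop :=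
  ∀ p, m p ≠ 0 → p.2 < n p.1

theorem eventually_inWindows (m : Fin r × ℕ →₀ ℕ) : ∀ᶠ n : Fin r → ℕ in atTop, InWindows n m := by
  filter_upwards [eventually_ge_atTop fun _ => m.support.sup fun p => p.2 + 1] with n hn p hp
  exact (Finset.le_sup (f := fun p : Fin r × ℕ => p.2 + 1)
    (Finsupp.mem_support_iff.2 hp)).trans (hn p.1)

theorem InWindows.length_rowPar_le {m : Fin r × ℕ →₀ ℕ} (hm : InWindows n m) (i : Fin r) :
    (rowPar m i).length ≤ n i := by
  rw [rowPar, length_ofFinsupp, ← Finset.card_range (n i)]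
  refine Finset.card_le_card fun j hj => Finset.mem_range.2 (hm (i, j) ?_)
  rwa [Finsupp.mem_support_iff, Finsupp.curry_apply] at hj

theorem inWindows_mapDomain_windowVar (q : Fin (∑ i, n i) →₀ ℕ) :
    InWindows n (q.mapDomain (windowVar n)) := by
  intro p hp
  rw [← mem_range_windowVar]
  by_contra h
  exact hp (Finsupp.mapDomain_of_notMem_range _ _ h)

/-- The composition of a tuple of partitions, as an exponent in the variables of the windows. -/
def windowFinsupp (ν : Fin r → Par) (n : Fin r → ℕ) : Fin (∑ i, n i) →₀ ℕ :=
  Finsupp.equivFunOnFinite.symm (windowComp ν n)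

theorem coe_windowFinsupp (ν : Fin r → Par) (n : Fin r → ℕ) :
    ⇑(windowFinsupp ν n) = windowComp ν n := rfl

/-- The reversal of the first `n` natural numbers. -/
def revBelow (n : ℕ) : Equiv.Perm ℕ :=
  Function.Involutive.toPerm (fun j => if j < n then n - (j + 1) else j) fun j => by grind

theorem mapDomain_windowFinsupp (hν : ∀ i, (ν i).length ≤ n i) :
    (windowFinsupp ν n).mapDomain (windowVar n) =
      (rowsFinsupp ν).mapDomain (Equiv.prodShear (Equiv.refl _) fun i => revBelow (n i)) := by
  ext ⟨i, j⟩
  have hright : (rowsFinsupp ν).mapDomain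
      (Equiv.prodShear (Equiv.refl _) fun i => revBelow (n i)) (i, j) =
        part (ν i) (if j < n i then n i - (j + 1) else j) := by
    rw [Finsupp.mapDomain_equiv_apply]
    exact rowsFinsupp_apply ν i _
  rw [hright]
  split_ifs with hj
  · have hleft := Finsupp.mapDomain_apply (windowVar_injective n) (windowFinsupp ν n)
      (finSigmaFinEquiv ⟨i, ⟨j, hj⟩⟩)
    rwa [windowVar_finSigmaFinEquiv, coe_windowFinsupp, windowComp_finSigmaFinEquiv,
      Fin.val_rev] at hleft
  · rw [Finsupp.mapDomain_of_notMem_range _ _ fun h => hj (mem_range_windowVar.1 h),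
      part_eq_zero_of_length_le ((hν i).trans (not_lt.1 hj))]

theorem rowPar_mapDomain_windowFinsupp (hν : ∀ i, (ν i).length ≤ n i) :
    rowPar ((windowFinsupp ν n).mapDomain (windowVar n)) = ν := by
  rw [mapDomain_windowFinsupp hν, rowPar_mapDomain_prodShear, rowPar_rowsFinsupp]

/-- The embedding of small windows into larger ones that aligns their right ends. -/
def windowEmb (h : n ≤ n') (k : Fin (∑ i, n i)) : Fin (∑ i, n' i) :=
  finSigmaFinEquiv (Sigma.map id (fun i j => (j.rev.castLE (h i)).rev) (finSigmaFinEquiv.symm k))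

theorem windowEmb_finSigmaFinEquiv (h : n ≤ n') (i : Fin r) (j : Fin (n i)) :
    windowEmb h (finSigmaFinEquiv ⟨i, j⟩) = finSigmaFinEquiv ⟨i, (j.rev.castLE (h i)).rev⟩ := by
  rw [windowEmb, Equiv.symm_apply_apply]
  rfl

theorem windowEmb_strictMono (h : n ≤ n') : StrictMono (windowEmb h) := by
  intro k l hkl
  obtain ⟨⟨i, j⟩, rfl⟩ := finSigmaFinEquiv.surjective k
  obtain ⟨⟨i', j'⟩, rfl⟩ := finSigmaFinEquiv.surjective l
  rw [windowEmb_finSigmaFinEquiv, windowEmb_finSigmaFinEquiv]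
  obtain hi | rfl | hi := lt_trichotomy i i'
  · exact finSigmaFinEquiv_lt_of_fst_lt hi
  · rw [finSigmaFinEquiv_lt_iff] at hkl ⊢
    exact Fin.rev_lt_rev.2 (Fin.rev_lt_rev.2 hkl)
  · exact absurd hkl (finSigmaFinEquiv_lt_of_fst_lt hi).not_gt

theorem windowComp_comp_windowEmb (h : n ≤ n') :
    windowComp μ n' ∘ windowEmb h = windowComp μ n := by
  funext k
  obtain ⟨⟨i, j⟩, rfl⟩ := finSigmaFinEquiv.surjective k
  rw [Function.comp_apply, windowEmb_finSigmaFinEquiv, windowComp_finSigmaFinEquiv,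
    windowComp_finSigmaFinEquiv, Fin.rev_rev, Fin.val_castLE]

theorem windowComp_eq_zero_of_notMem_range (h : n ≤ n') (hμ : ∀ i, (μ i).length ≤ n i)
    {k : Fin (∑ i, n' i)} (hk : k ∉ Set.range (windowEmb h)) : windowComp μ n' k = 0 := by
  obtain ⟨⟨i, j⟩, rfl⟩ := finSigmaFinEquiv.surjective k
  rw [windowComp_finSigmaFinEquiv]
  refine part_eq_zero_of_length_le ((hμ i).trans (not_lt.1 fun hlt => hk ?_))
  refine ⟨finSigmaFinEquiv ⟨i, Fin.rev ⟨j.rev, hlt⟩⟩, ?_⟩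
  rw [windowEmb_finSigmaFinEquiv, Fin.rev_rev, Fin.castLE_mk, Fin.eta, Fin.rev_rev]

theorem windowFinsupp_mapDomain_windowEmb (h : n ≤ n') (hν : ∀ i, (ν i).length ≤ n i) :
    (windowFinsupp ν n).mapDomain (windowEmb h) = windowFinsupp ν n' := by
  ext k
  by_cases hk : k ∈ Set.range (windowEmb h)
  · obtain ⟨k, rfl⟩ := hk
    rw [Finsupp.mapDomain_apply (windowEmb_strictMono h).injective, coe_windowFinsupp,
      coe_windowFinsupp, ← windowComp_comp_windowEmb h, Function.comp_apply]
  · rw [Finsupp.mapDomain_of_notMem_range _ _ hk, coe_windowFinsupp,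
      windowComp_eq_zero_of_notMem_range h hν hk]

end Windows

/-! ### Multi-symmetric Schur functions as limits -/

section Limit

variable {r : ℕ} {n n' : Fin r → ℕ} {μ ν : Fin r → Par}

theorem coeff_keyPoly_windowComp_of_le {R : Type*} [CommRing R] [IsDomain R] (h : n ≤ n')
    (hμ : ∀ i, (μ i).length ≤ n i) (hν : ∀ i, (ν i).length ≤ n i) :
    (keyPoly R (∑ i, n' i) (windowComp μ n')).coeff (windowFinsupp ν n') =
      (keyPoly R (∑ i, n i) (windowComp μ n)).coeff (windowFinsupp ν n) := by
  rw [← windowComp_comp_windowEmb h, ← killCompl_keyPoly (windowEmb_strictMono h) fun _ =>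
      windowComp_eq_zero_of_notMem_range h hμ, MvPolynomial.coeff_killCompl,
    windowFinsupp_mapDomain_windowEmb h hν]

theorem multiSchurPoly_eq_rename (μ : Fin r → Par) (n : Fin r → ℕ) :
    multiSchurPoly μ n =
      MvPolynomial.rename (windowVar n) (keyPoly ℤ (∑ i, n i) (windowComp μ n)) := rfl

theorem swapVar_multiSchurPoly {i : Fin r} {j : ℕ} (hj : j + 1 < n i) :
    swapVar (i, j) (i, j + 1) (multiSchurPoly μ n) = multiSchurPoly μ n := by
  have hsymm := swapVar_keyPoly (R := ℤ) (α := windowComp μ n)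
    (i := finSigmaFinEquiv ⟨i, ⟨j, by omega⟩⟩) (j := finSigmaFinEquiv ⟨i, ⟨j + 1, hj⟩⟩)
    (by rw [finSigmaFinEquiv_val, finSigmaFinEquiv_val, add_assoc]) (by
      rw [windowComp_finSigmaFinEquiv, windowComp_finSigmaFinEquiv, Fin.val_rev, Fin.val_rev]
      exact part_antitone _ (Nat.sub_le_sub_left (Nat.le_succ _) _))
  rw [multiSchurPoly_eq_rename]
  conv_rhs => rw [← hsymm]
  rw [swapVar, swapVar, MvPolynomial.rename_rename, MvPolynomial.rename_rename]
  congr 2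
  funext k
  rw [Function.comp_apply, Function.comp_apply, ← (windowVar_injective n).swap_apply,
    windowVar_finSigmaFinEquiv, windowVar_finSigmaFinEquiv]

theorem coeff_multiSchurPoly_eq_coeff_rowsFinsupp {m : Fin r × ℕ →₀ ℕ} (hm : InWindows n m) :
    (multiSchurPoly μ n).coeff m = (multiSchurPoly μ n).coeff (rowsFinsupp (rowPar m)) := by
  induction m using sort_induction (r := fun p q : Fin r × ℕ => q = (p.1, p.2 + 1))
    (h := Prod.snd) (fun p q hq => by simp only [hq, Nat.lt_succ_self]) with
  | sorted m hsorted =>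
    rw [rowsFinsupp_rowPar fun i => antitone_nat_of_succ_le fun j => hsorted _ _ rfl]
  | swap m p q hpq hlt ih =>
    obtain ⟨i, j⟩ := p
    obtain rfl : q = (i, j + 1) := hpq
    have hj : j + 1 < n i := hm (i, j + 1) (Nat.ne_zero_of_lt hlt)
    rw [rowPar_mapDomain_swap] at ih
    rw [← ih, ← swapVar_multiSchurPoly hj, swapVar,
      MvPolynomial.coeff_rename_mapDomain _ (Equiv.injective _), ← swapVar,
      swapVar_multiSchurPoly hj]
    intro p hp
    rw [Finsupp.mapDomain_equiv_apply, Equiv.symm_swap, Equiv.swap_apply_def] at hp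
    split_ifs at hp with hleft hright
    · subst hleft
      exact (Nat.lt_succ_self j).trans hj
    · subst hright
      exact hj
    · exact hm p hp

theorem coeff_multiSchurPoly {m : Fin r × ℕ →₀ ℕ} (hm : InWindows n m) :
    (multiSchurPoly μ n).coeff m =
      (keyPoly ℤ (∑ i, n i) (windowComp μ n)).coeff (windowFinsupp (rowPar m) n) := by
  rw [coeff_multiSchurPoly_eq_coeff_rowsFinsupp hm,
    ← rowPar_mapDomain_windowFinsupp hm.length_rowPar_le,
    ← coeff_multiSchurPoly_eq_coeff_rowsFinsupp (inWindows_mapDomain_windowVar _),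
    rowPar_mapDomain_windowFinsupp hm.length_rowPar_le, multiSchurPoly_eq_rename,
    MvPolynomial.coeff_rename_mapDomain _ (windowVar_injective n)]

theorem tendsto_coeff_multiSchurPoly {m : Fin r × ℕ →₀ ℕ} (hμ : ∀ i, (μ i).length ≤ n i)
    (hm : ∀ i, (rowPar m i).length ≤ n i) :
    Tendsto (fun n' : Fin r → ℕ =>
        MvPowerSeries.coeff m (multiSchurPoly μ n' : MvPowerSeries (Fin r × ℕ) ℤ)) atTop
      (𝓝 ((keyPoly ℤ (∑ i, n i) (windowComp μ n)).coeff (windowFinsupp (rowPar m) n))) := by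
  refine tendsto_const_nhds.congr' ?_
  filter_upwards [eventually_ge_atTop n, eventually_inWindows m] with n' hn' hwin
  rw [MvPolynomial.coeff_coe, coeff_multiSchurPoly hwin, coeff_keyPoly_windowComp_of_le hn' hμ hm]

theorem tendsto_multiSchurPoly (μ : Fin r → Par) :
    Tendsto (fun n : Fin r → ℕ => (multiSchurPoly μ n : MvPowerSeries (Fin r × ℕ) ℤ)) atTop
      (𝓝 (multiSchur μ)) := by
  let n (m : Fin r × ℕ →₀ ℕ) (i : Fin r) : ℕ := max (μ i).length (rowPar m i).length
  let limit : MvPowerSeries (Fin r × ℕ) ℤ := fun m =>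
    (keyPoly ℤ (∑ i, n m i) (windowComp μ (n m))).coeff (windowFinsupp (rowPar m) (n m))
  exact tendsto_nhds_limUnder
    ⟨limit, (MvPowerSeries.WithPiTopology.tendsto_iff_coeff_tendsto _ _ _).2 fun _ =>
      tendsto_coeff_multiSchurPoly (fun _ => le_max_left _ _) fun _ => le_max_right _ _⟩

theorem coeff_multiSchur {m : Fin r × ℕ →₀ ℕ} (hμ : ∀ i, (μ i).length ≤ n i)
    (hm : ∀ i, (rowPar m i).length ≤ n i) :
    MvPowerSeries.coeff m (multiSchur μ) =
      (keyPoly ℤ (∑ i, n i) (windowComp μ n)).coeff (windowFinsupp (rowPar m) n) :=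
  tendsto_nhds_unique ((MvPowerSeries.WithPiTopology.tendsto_iff_coeff_tendsto _ _ _).1
    (tendsto_multiSchurPoly μ) m) (tendsto_coeff_multiSchurPoly hμ hm)

theorem coeff_multiSchur_eq_coeff_rowsFinsupp (μ : Fin r → Par) (m : Fin r × ℕ →₀ ℕ) :
    MvPowerSeries.coeff m (multiSchur μ) =
      MvPowerSeries.coeff (rowsFinsupp (rowPar m)) (multiSchur μ) := by
  have hm (i : Fin r) := le_max_right (μ i).length (rowPar m i).length
  rw [coeff_multiSchur (fun _ => le_max_left _ _) hm,
    coeff_multiSchur (fun _ => le_max_left _ _) (by rwa [rowPar_rowsFinsupp]), rowPar_rowsFinsupp]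

theorem coeff_rowsFinsupp_multiSchur (hμ : ∀ i, (μ i).length ≤ n i)
    (hν : ∀ i, (ν i).length ≤ n i) :
    MvPowerSeries.coeff (rowsFinsupp ν) (multiSchur μ) =
      (keyPoly ℤ (∑ i, n i) (windowComp μ n)).coeff (windowFinsupp ν n) := by
  rw [coeff_multiSchur hμ (by rwa [rowPar_rowsFinsupp]), rowPar_rowsFinsupp]

end Limit

/-! ### Triangularity -/

section Triangularity

variable {r : ℕ} {n : Fin r → ℕ} {μ ν : Fin r → Par}

theorem degree_eq_sum_rowPar (m : Fin r × ℕ →₀ ℕ) : m.degree = ∑ i, (rowPar m i).1 := by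
  conv_lhs => rw [← sum_mapDomain_curry m, map_sum]
  exact Finset.sum_congr rfl fun i _ => Finsupp.degree_mapDomain _ _

theorem degree_windowFinsupp (hν : ∀ i, (ν i).length ≤ n i) :
    (windowFinsupp ν n).degree = ∑ i, (ν i).1 := by
  rw [← Finsupp.degree_mapDomain (windowVar n), degree_eq_sum_rowPar,
    rowPar_mapDomain_windowFinsupp hν]

theorem length_le_sum_size (μ : Fin r → Par) (i : Fin r) : (μ i).length ≤ ∑ i, (μ i).1 :=
  (μ i).length_le_size.trans
    (Finset.single_le_sum (f := fun i => (μ i).1) (fun _ _ => Nat.zero_le _) (Finset.mem_univ i))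

theorem coeff_rowsFinsupp_multiSchur_self (μ : Fin r → Par) :
    MvPowerSeries.coeff (rowsFinsupp μ) (multiSchur μ) = 1 := by
  rw [coeff_rowsFinsupp_multiSchur (fun _ => le_rfl) fun _ => le_rfl]
  exact coeff_keyPoly_self (windowFinsupp μ _)

theorem size_eq_and_rank_lt_of_coeff_multiSchur_ne_zero (hμ : ∀ i, (μ i).length ≤ n i)
    (hν : ∀ i, (ν i).length ≤ n i) (hne : ν ≠ μ)
    (h : MvPowerSeries.coeff (rowsFinsupp ν) (multiSchur μ) ≠ 0) :
    ∑ i, (ν i).1 = ∑ i, (μ i).1 ∧ rank (windowComp ν n) < rank (windowComp μ n) := by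
  have hne' : windowFinsupp ν n ≠ windowFinsupp μ n := fun heq => hne <| by
    rw [← rowPar_mapDomain_windowFinsupp hν, heq, rowPar_mapDomain_windowFinsupp hμ]
  rw [coeff_rowsFinsupp_multiSchur hμ hν] at h
  rw [← degree_windowFinsupp hμ, ← degree_windowFinsupp hν]
  exact degree_eq_and_rank_lt_of_coeff_keyPoly_ne_zero hne' h

theorem sum_size_eq_of_coeff_multiSchur_ne_zero
    (h : MvPowerSeries.coeff (rowsFinsupp ν) (multiSchur μ) ≠ 0) :
    ∑ i, (ν i).1 = ∑ i, (μ i).1 := by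
  obtain rfl | hne := eq_or_ne ν μ
  · rfl
  · exact (size_eq_and_rank_lt_of_coeff_multiSchur_ne_zero (fun _ => le_max_left _ _)
      (fun _ => le_max_right _ _) hne h).1

theorem rank_lt_of_coeff_multiSchur_ne_zero (hne : ν ≠ μ)
    (h : MvPowerSeries.coeff (rowsFinsupp ν) (multiSchur μ) ≠ 0) :
    rank (windowComp ν fun _ => ∑ i, (ν i).1) < rank (windowComp μ fun _ => ∑ i, (μ i).1) := by
  have hsize := sum_size_eq_of_coeff_multiSchur_ne_zero h
  rw [hsize]
  exact (size_eq_and_rank_lt_of_coeff_multiSchur_ne_zero (length_le_sum_size μ)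
    (hsize ▸ length_le_sum_size ν) hne h).2

theorem finite_setOf_sum_size_eq (d : ℕ) : {ν : Fin r → Par | ∑ i, (ν i).1 = d}.Finite := by
  refine (Set.Finite.pi' fun _ => finite_setOf_size_le d).subset fun ν hν i => ?_
  exact (Finset.single_le_sum (f := fun i => (ν i).1) (fun _ _ => Nat.zero_le _)
    (Finset.mem_univ i)).trans_eq hν

theorem exists_toPowerSeries_eq_multiSchur (μ : Fin r → Par) :
    ∃ t, toPowerSeries ℤ r t = multiSchur μ :=
  exists_toPowerSeries_eq (coeff_multiSchur_eq_coeff_rowsFinsupp μ)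
    ((finite_setOf_sum_size_eq _).subset fun _ => sum_size_eq_of_coeff_multiSchur_ne_zero)

theorem exists_basis_multiSchur (r : ℕ) :
    ∃ b : Module.Basis (Fin r → Par) ℤ (MultiSymFun ℤ r),
      ∀ μ, toPowerSeries ℤ r (b μ) = multiSchur μ := by
  choose v hv using exists_toPowerSeries_eq_multiSchur (r := r)
  have hrepr (μ ν : Fin r → Par) : (multiMonomialBasis ℤ r).repr (v μ) ν =
      MvPowerSeries.coeff (rowsFinsupp ν) (multiSchur μ) := by
    rw [← hv, coeff_toPowerSeries, rowPar_rowsFinsupp]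
  obtain ⟨b, hb⟩ := exists_basis_of_unitriangular (b := multiMonomialBasis ℤ r) (v := v)
    (ρ := fun μ => rank (windowComp μ fun _ => ∑ i, (μ i).1))
    (fun μ => by rw [hrepr, coeff_rowsFinsupp_multiSchur_self])
    (fun μ ν h hne => rank_lt_of_coeff_multiSchur_ne_zero hne (by rwa [hrepr] at h))
  exact ⟨b, fun μ => by rw [hb, hv]⟩

end Triangularity

end

end MultiSchur

theorem mainTheorem8 (r : ℕ) :
    (∀ μ : Fin r → MultiSchur.Par,
      Tendsto (fun n : Fin r → ℕ =>
          (MultiSchur.multiSchurPoly μ n : MvPowerSeries (Fin r × ℕ) ℤ))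
        atTop (𝓝 (MultiSchur.multiSchur μ))) ∧
    Function.Injective (MultiSchur.toPowerSeries ℤ r) ∧
    ∃ b : Module.Basis (Fin r → MultiSchur.Par) ℤ (MultiSchur.MultiSymFun ℤ r),
      ∀ μ : Fin r → MultiSchur.Par,
        MultiSchur.toPowerSeries ℤ r (b μ) = MultiSchur.multiSchur μ :=
  ⟨MultiSchur.tendsto_multiSchurPoly, MultiSchur.toPowerSeries_injective,
    MultiSchur.exists_basis_multiSchur r⟩
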